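/- Let $\mathbf F_q$ be a finite field of odd order $q$, $A=\mathbf F_q[t]$, $K=\mathbf F_q(t)$, $K_\infty=\mathbf F_q((1/t))$. A quadratic form $Q$ on a finite-dimensional $K$-vector space $W$ is called definite if its extension to $K_\infty\otimes_K W$ is anisotropic. An $A$-lattice in $W$ is a finitely generated $A$-submodule $L$ spanning $W$ over $K$; its representation numbers are $R(L,Q,a)=|\{v\in L: Q(v)=a\}|$ for $a\in K$ ($Q$ need not take values in $A$ on $L$). Let $L\subset W$ and $L'\subset W'$ be $A$-lattices in definite quadratic spaces $(W,Q)$ and $(W',Q')$ over $K$, of arbitrary ranks, and suppose that $R(L,Q,a)=R(L',Q',a)$ for all $a\in K$. Then: 1. $(L,Q)$ and $(L',Q')$ belong to the same genus, i.e. they are isometric at every place of $K$: for every nonzero prime ideal $\mathfrak p$ of $A$, with completions $A_{\mathfrak p}\subset K_{\mathfrak p}$, there is an isometry $K_{\mathfrak p}\otimes_K W\to K_{\mathfrak p}\otimes_K W'$ of quadratic spaces over $K_{\mathfrak p}$ that carries $L_{\mathfrak p}$ (the $A_{\mathfrak p}$-span of $L$) onto $L'_{\mathfrak p}$, and the quadratic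 spaces $K_\infty\otimes_K W$ and $K_\infty\otimes_K W'$ over $K_\infty$ are isometric. 2. $(L,Q)$ and $(L',Q')$ have the same discriminant in $K/(A^\times)^2$, where the discriminant of $(L,Q)$ is the class, modulo squares of units of $A$, of the determinant of the Gram matrix $\left(\tfrac12 B(v_i,v_j)\right)$ of any $A$-basis $(v_i)$ of $L$, with $B(x,y)=Q(x+y)-Q(x)-Q(y)$. -/

import Mathlib

open scoped Polynomial TensorProduct
open IsDedekindDomain

namespace FqtLattice

/-- If `2 ≠ 0` in `F`, then `2` is invertible in `K = F(t)`. -/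
noncomputable instance invertibleTwo (F : Type*) [Field F] [NeZero (2 : F)] :
    Invertible (2 : RatFunc F) :=
  invertibleOfNonzero (by
    have h := (map_ne_zero (algebraMap F (RatFunc F))).2 (NeZero.ne (2 : F))
    rwa [map_ofNat] at h)

open scoped Classical in
/-- The field `K_∞ = F((1/t))`, the completion of `F(t)` at the place at infinity. -/
noncomputable abbrev KInfty (F : Type*) [Field F] : Type _ := RatFunc.CompletionAtInfty F

/-- The extension `K_∞ ⊗ Q` of a quadratic form over `K = F(t)` to `K_∞ = F((1/t))`. -/
noncomputable abbrev atInfty {F : Type*} [Field F] [NeZero (2 : F)]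
    {W : Type*} [AddCommGroup W] [Module (RatFunc F) W] (Q : QuadraticForm (RatFunc F) W) :
    QuadraticForm (KInfty F) (KInfty F ⊗[RatFunc F] W) :=
  QuadraticForm.baseChange (KInfty F) Q

/-- The extension `K_p ⊗ Q` of a quadratic form over `K = F(t)` to the completion `K_p` at a
nonzero prime `p` of `F[t]`. -/
noncomputable abbrev atPrime {F : Type*} [Field F] [NeZero (2 : F)]
    {W : Type*} [AddCommGroup W] [Module (RatFunc F) W]
    (p : HeightOneSpectrum F[X]) (Q : QuadraticForm (RatFunc F) W) :
    QuadraticForm (p.adicCompletion (RatFunc F)) (p.adicCompletion (RatFunc F) ⊗[RatFunc F] W) :=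
  QuadraticForm.baseChange (p.adicCompletion (RatFunc F)) Q

/-- `Q` is definite if it is anisotropic over `K_∞`. -/
def IsDefinite {F : Type*} [Field F] [NeZero (2 : F)]
    {W : Type*} [AddCommGroup W] [Module (RatFunc F) W]
    (Q : QuadraticForm (RatFunc F) W) : Prop :=
  (atInfty Q).Anisotropic

/-- The representation number `R(L, Q, a)`: the number of `v ∈ L` with `Q v = a`. -/
noncomputable def repNumber {F : Type*} [Field F]
    {W : Type*} [AddCommGroup W] [Module (RatFunc F) W] [Module F[X] W]
    (L : Submodule F[X] W) (Q : QuadraticForm (RatFunc F) W) (a : RatFunc F) : ℕ∞ :=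
  {v : W | v ∈ L ∧ Q v = a}.encard

/-- Isospectral lattices: all representation numbers `R(L, Q, a)`, `a ∈ K`, agree. -/
def Isospectral {F : Type*} [Field F]
    {W : Type*} [AddCommGroup W] [Module (RatFunc F) W] [Module F[X] W]
    {W' : Type*} [AddCommGroup W'] [Module (RatFunc F) W'] [Module F[X] W']
    (L : Submodule F[X] W) (Q : QuadraticForm (RatFunc F) W)
    (L' : Submodule F[X] W') (Q' : QuadraticForm (RatFunc F) W') : Prop :=
  ∀ a : RatFunc F, repNumber L Q a = repNumber L' Q' a

/-- The completion `L_p` of `L` at `p`: the `A_p`-submodule of `K_p ⊗ W` generated by `L`. -/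
noncomputable def completionAt {F : Type*} [Field F]
    {W : Type*} [AddCommGroup W] [Module (RatFunc F) W] [Module F[X] W]
    (p : HeightOneSpectrum F[X]) (L : Submodule F[X] W) :
    Submodule (p.adicCompletionIntegers (RatFunc F))
      (p.adicCompletion (RatFunc F) ⊗[RatFunc F] W) :=
  Submodule.span _ ((fun w : W => (1 : p.adicCompletion (RatFunc F)) ⊗ₜ[RatFunc F] w) '' (L : Set W))

/-- `(L_p, Q)` and `(L'_p, Q')` are isometric: some isometry of the quadratic spaces over `K_p`
carries `L_p` onto `L'_p`. -/
def IsometricAt {F : Type*} [Field F] [NeZero (2 : F)]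
    {W : Type*} [AddCommGroup W] [Module (RatFunc F) W] [Module F[X] W]
    {W' : Type*} [AddCommGroup W'] [Module (RatFunc F) W'] [Module F[X] W']
    (p : HeightOneSpectrum F[X])
    (L : Submodule F[X] W) (Q : QuadraticForm (RatFunc F) W)
    (L' : Submodule F[X] W') (Q' : QuadraticForm (RatFunc F) W') : Prop :=
  ∃ e : (atPrime p Q).IsometryEquiv (atPrime p Q'),
    (fun x => e x) '' (completionAt p L : Set (p.adicCompletion (RatFunc F) ⊗[RatFunc F] W)) =
      (completionAt p L' : Set (p.adicCompletion (RatFunc F) ⊗[RatFunc F] W'))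

/-- Two lattices are in the same genus if they are isometric at every place of `F(t)`: the
completed lattices at every nonzero prime of `F[t]`, and the quadratic spaces over `K_∞` at the
place at infinity. -/
def SameGenus {F : Type*} [Field F] [NeZero (2 : F)]
    {W : Type*} [AddCommGroup W] [Module (RatFunc F) W] [Module F[X] W]
    {W' : Type*} [AddCommGroup W'] [Module (RatFunc F) W'] [Module F[X] W']
    (L : Submodule F[X] W) (Q : QuadraticForm (RatFunc F) W)
    (L' : Submodule F[X] W') (Q' : QuadraticForm (RatFunc F) W') : Prop :=
  (∀ p : HeightOneSpectrum F[X], IsometricAt p L Q L' Q') ∧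
    (atInfty Q).Equivalent (atInfty Q')

/-- The Gram matrix `(B(vᵢ, vⱼ) / 2)`, `B(x, y) = Q(x + y) - Q(x) - Q(y)`, of a basis of `L`. -/
noncomputable def gram {F : Type*} [Field F]
    {W : Type*} [AddCommGroup W] [Module (RatFunc F) W] [Module F[X] W]
    {L : Submodule F[X] W} (Q : QuadraticForm (RatFunc F) W)
    {n : ℕ} (b : Module.Basis (Fin n) F[X] L) : Matrix (Fin n) (Fin n) (RatFunc F) :=
  Matrix.of fun i j => QuadraticMap.polar Q (b i : W) (b j : W) / 2

/-- The discriminant of `L`, as a class in `K / (A^×)²`: the set of all `u² · det G`, where `u` is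
a unit of `A = F[t]` and `G` is the Gram matrix of an `A`-basis of `L`. -/
def discriminant {F : Type*} [Field F]
    {W : Type*} [AddCommGroup W] [Module (RatFunc F) W] [Module F[X] W]
    (L : Submodule F[X] W) (Q : QuadraticForm (RatFunc F) W) : Set (RatFunc F) :=
  {d | ∃ (n : ℕ) (b : Module.Basis (Fin n) F[X] L) (u : F[X]ˣ),
    d = algebraMap F[X] (RatFunc F) (u : F[X]) ^ 2 * (gram Q b).det}

end FqtLattice

/-! Counting vectors by value determines every local quadratic Gauss sum, and over a complete
discrete valuation ring with `2` invertible these Gauss sums determine the form.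

Definiteness gives a Cauchy–Schwarz inequality at infinity, so the vectors of `L` whose value has
degree at most `2N` form a finite group, and this ball is cut out by the values of `Q` alone.
Isospectrality therefore provides, for every `N`, a value-preserving bijection between the balls of
`L` and `L'`; it need not be additive (`Isospectral.exists_equiv_latticeBall`). At a finite prime,
the ball for large `N` is a group mapping onto `L_p / I L_p`. At infinity, the ball multiplied by
`t^(-N)` maps onto the classes modulo `I` of the coordinate lattice of a suitable orthogonal basis.
In both cases the average of `ψ (c Q)` over the quotient equals its average over the finite group,
which depends only on the multiset of values (`IsLocalForm.gaussMean_eq`). So all Gauss means of the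
two local forms agree.

Equal Gauss means force isometry by induction on the rank (`equivalent_of_gaussMean_eq`). Fourier
inversion shows that the forms represent the same classes modulo every nonzero ideal. A value `a` of
minimal valuation of one form is then represented exactly by the other, since every element of `1 +
m` is a square. Both forms split off `a x²`, whose Gauss sum is nonzero and can be cancelled.

For the discriminants, the local isometries make the quotient of Gram determinants a unit square at
every finite prime. Such an element of `F(t)` is a constant, and it is a square in `F` by reduction
modulo `t`. -/

namespace FqtLattice

/-! ### Averages over finite groups and one-variable Gauss sums. -/

/-- The average of a complex function on a finite type. -/
noncomputable def mean {G : Type*} [Finite G] (g : G → ℂ) : ℂ :=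
  letI := Fintype.ofFinite G
  (∑ x, g x) / Nat.card G

theorem mean_eq {G : Type*} [Fintype G] (g : G → ℂ) : mean g = (∑ x, g x) / Nat.card G := by
  unfold mean
  congr
  exact Subsingleton.elim _ _

theorem mean_comp {G H : Type*} [AddGroup G] [AddGroup H] [Finite G] [Finite H] (φ : G →+ H)
    (hφ : Function.Surjective φ) (g : H → ℂ) : mean (fun x => g (φ x)) = mean g := by
  classical
  let := Fintype.ofFinite G
  let := Fintype.ofFinite H
  rw [mean_eq, mean_eq]
  have hfib : ∀ y, (Finset.univ.filter fun x => φ x = y).card =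
      (Finset.univ.filter fun x => φ x = 0).card := fun y =>
    AddMonoidHom.card_fiber_eq_of_mem_range φ (hφ y) (hφ 0)
  set c := (Finset.univ.filter fun x => φ x = 0).card with hc
  have h1 : ∑ x, g (φ x) = c * ∑ y, g y := by
    rw [← Finset.sum_fiberwise Finset.univ φ, Finset.mul_sum]
    refine Finset.sum_congr rfl fun y _ => ?_
    rw [Finset.sum_congr rfl (g := fun _ => g y) (by simp +contextual), Finset.sum_const, hfib y,
      nsmul_eq_mul]
  have h2 : (Nat.card G : ℂ) = c * Nat.card H := by
    have : Fintype.card G = ∑ y : H, (Finset.univ.filter fun x => φ x = y).card := by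
      rw [← Finset.card_univ,
        Finset.card_eq_sum_card_fiberwise (f := φ) (t := Finset.univ) (by simp)]
    rw [Nat.card_eq_fintype_card, Nat.card_eq_fintype_card, this]
    simp [hfib, mul_comm]
  have hc0 : (c : ℂ) ≠ 0 := by
    intro h
    rw [h, zero_mul] at h2
    exact Nat.card_pos.ne' (by exact_mod_cast h2)
  rw [h1, h2, mul_div_mul_left _ _ hc0]

theorem mean_congr_of_surjective {M G H : Type*} [AddGroup M] [AddGroup G] [AddGroup H] [Finite G]
    [Finite H] (φ : M →+ G) (hφ : Function.Surjective φ) (χ : M →+ H) (hχ : Function.Surjective χ)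
    (f : G → ℂ) (g : H → ℂ) (h : ∀ x, f (φ x) = g (χ x)) : mean f = mean g := by
  -- `M` may be infinite, but its image in `G × H` is finite and projects onto both factors.
  let S := (φ.prod χ).range
  have h1 := mean_comp ((AddMonoidHom.fst G H).comp S.subtype)
    (fun y => by obtain ⟨x, rfl⟩ := hφ y; exact ⟨⟨_, x, rfl⟩, rfl⟩) f
  have h2 := mean_comp ((AddMonoidHom.snd G H).comp S.subtype)
    (fun y => by obtain ⟨x, rfl⟩ := hχ y; exact ⟨⟨_, x, rfl⟩, rfl⟩) g
  rw [← h1, ← h2]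
  congr 1
  funext ⟨_, x, rfl⟩
  exact h x

theorem mean_prod {G H : Type*} [Finite G] [Finite H] (f : G → ℂ) (g : H → ℂ) :
    mean (fun x : G × H => f x.1 * g x.2) = mean f * mean g := by
  let := Fintype.ofFinite G
  let := Fintype.ofFinite H
  rw [mean_eq, mean_eq, mean_eq, Fintype.sum_prod_type, Nat.card_prod, Nat.cast_mul,
    div_mul_div_comm, Finset.sum_mul_sum]

/-- The Gauss sum of `x ↦ a x²` over a finite ring in which `2` is invertible does not vanish. -/
theorem sum_addChar_mul_sq_ne_zero {R : Type*} [CommRing R] [Fintype R] (h2 : IsUnit (2 : R))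
    (ψ : AddChar R ℂ) (a : R) : ∑ x, ψ (a * x ^ 2) ≠ 0 := by
  classical
  intro h0
  -- Putting `x = u + y` turns `a x² - a y²` into `a u² + 2 a u y`. The sum over `y` vanishes unless
  -- the shifted character is trivial, and then `a u² = 2 a u (u / 2)` gives `ψ (a u²) = 1`.
  have key : (∑ x, ψ (a * x ^ 2)) * (∑ y, ψ (-(a * y ^ 2))) =
      ∑ u, if ψ.mulShift (2 * a * u) = 0 then (Fintype.card R : ℂ) else 0 := by
    rw [Finset.sum_mul_sum, Finset.sum_comm]
    have : ∀ y, ∑ x, ψ (a * x ^ 2) * ψ (-(a * y ^ 2)) =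
        ∑ u, ψ (a * u ^ 2) * ψ.mulShift (2 * a * u) y := fun y => by
      rw [← Equiv.sum_comp (Equiv.addRight y)]
      refine Finset.sum_congr rfl fun u _ => ?_
      rw [AddChar.mulShift_apply, ← AddChar.map_add_eq_mul, ← AddChar.map_add_eq_mul]
      congr 1
      simp only [Equiv.coe_addRight]
      ring
    rw [Finset.sum_congr rfl fun y _ => this y, Finset.sum_comm]
    refine Finset.sum_congr rfl fun u _ => ?_
    rw [← Finset.mul_sum, AddChar.sum_eq_ite]
    split_ifs with h
    · obtain ⟨w, hw⟩ := h2
      have : a * u ^ 2 = 2 * a * u * (↑w⁻¹ * u) := by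
        have : (2 : R) * ↑w⁻¹ = 1 := by rw [← hw, Units.mul_inv]
        linear_combination (-a * u ^ 2) * this
      rw [this, ← AddChar.mulShift_apply, h, AddChar.zero_apply, one_mul]
    · rw [mul_zero]
  rw [h0, zero_mul, ← Nat.cast_zero] at key
  have key' : (0 : ℕ) = ∑ u, if ψ.mulShift (2 * a * u) = 0 then Fintype.card R else 0 := by
    exact_mod_cast key
  -- All terms are nonnegative, and the term `u = 0` is the cardinality of `R`.
  have := (Finset.sum_eq_zero_iff.1 key'.symm) 0 (Finset.mem_univ _)
  rw [if_pos] at this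
  · exact Fintype.card_ne_zero this
  · ext; simp

/-! ### Gauss means of quadratic forms modulo an ideal. -/

section GaussMean

variable {O : Type*} [CommRing O] {M : Type*} [AddCommGroup M] [Module O M]

/-- For `d ∈ I M`, both `q d` and all polar values of `d` lie in `I`, so `q` modulo `I` descends to
`M / I M` and the choice of representatives in `gaussMean` is harmless. -/
theorem mk_quadraticForm_out (I : Ideal O) (q : QuadraticForm O M) (x : M) :
    Ideal.Quotient.mk I (q (Submodule.mkQ (I • ⊤ : Submodule O M) x).out) =
      Ideal.Quotient.mk I (q x) := by
  set y := (Submodule.mkQ (I • ⊤ : Submodule O M) x).out with hy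
  have hd : y - x ∈ (I • ⊤ : Submodule O M) := by
    rw [← Submodule.Quotient.eq]
    exact Quotient.out_eq' _
  have : ∀ d ∈ (I • ⊤ : Submodule O M), q d ∈ I ∧ ∀ z, QuadraticMap.polar q d z ∈ I := by
    intro d hd
    refine Submodule.smul_induction_on hd ?_ ?_
    · intro r hr n _
      refine ⟨?_, fun z => ?_⟩
      · rw [QuadraticMap.map_smul, smul_eq_mul]
        exact I.mul_mem_right _ (I.mul_mem_left _ hr)
      · rw [QuadraticMap.polar_smul_left, smul_eq_mul]
        exact I.mul_mem_right _ hr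
    · intro a b ha hb
      refine ⟨?_, fun z => ?_⟩
      · rw [QuadraticMap.map_add q]
        exact I.add_mem (I.add_mem ha.1 hb.1) (ha.2 b)
      · rw [QuadraticMap.polar_add_left]
        exact I.add_mem (ha.2 z) (hb.2 z)
  obtain ⟨h1, h2⟩ := this _ hd
  rw [Ideal.Quotient.eq]
  have h3 := QuadraticMap.map_add q (y - x) x
  rw [sub_add_cancel] at h3
  rw [h3]
  convert I.add_mem h1 (h2 x) using 1
  ring

variable (M) in
theorem finite_quotient_smul_top [Module.Finite O M] (I : Ideal O) [Finite (O ⧸ I)] :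
    Finite (M ⧸ (I • ⊤ : Submodule O M)) :=
  Module.finite_of_finite (O ⧸ I)

/-- The average of `ψ (q x)` over `x ∈ M / I M`. -/
noncomputable def gaussMean [Module.Finite O M] (I : Ideal O) [Finite (O ⧸ I)]
    (ψ : AddChar (O ⧸ I) ℂ) (q : QuadraticForm O M) : ℂ :=
  haveI := finite_quotient_smul_top M I
  mean fun x : M ⧸ (I • ⊤ : Submodule O M) => ψ (Ideal.Quotient.mk I (q x.out))

variable [Module.Finite O M] {I : Ideal O} [Finite (O ⧸ I)]

theorem gaussMean_eq_mean {G : Type*} [AddGroup G] [Finite G] {ψ : AddChar (O ⧸ I) ℂ}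
    {q : QuadraticForm O M} (φ : M →+ G) (hφ : Function.Surjective φ) (g : G → ℂ)
    (h : ∀ x, ψ (Ideal.Quotient.mk I (q x)) = g (φ x)) : gaussMean I ψ q = mean g := by
  have := finite_quotient_smul_top M I
  refine mean_congr_of_surjective (Submodule.mkQ (I • ⊤ : Submodule O M)).toAddMonoidHom
    (Submodule.mkQ_surjective _) φ hφ _ g fun x => ?_
  rw [← h]
  exact congrArg ψ (mk_quadraticForm_out I q x)

theorem gaussMean_congr {M' : Type*} [AddCommGroup M'] [Module O M'] [Module.Finite O M']
    {q : QuadraticForm O M} {q' : QuadraticForm O M'} (h : q.Equivalent q')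
    (ψ : AddChar (O ⧸ I) ℂ) : gaussMean I ψ q = gaussMean I ψ q' := by
  have := finite_quotient_smul_top M' I
  obtain ⟨e⟩ := h
  refine gaussMean_eq_mean
    ((Submodule.mkQ (I • ⊤ : Submodule O M')).toAddMonoidHom.comp
      e.toLinearEquiv.toAddEquiv.toAddMonoidHom)
    ((Submodule.mkQ_surjective _).comp e.toLinearEquiv.surjective) _ fun x => ?_
  rw [← e.map_app x]
  exact congrArg ψ (mk_quadraticForm_out I q' (e x)).symm

theorem gaussMean_prod {M' : Type*} [AddCommGroup M'] [Module O M'] [Module.Finite O M']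
    (q : QuadraticForm O M) (q' : QuadraticForm O M') (ψ : AddChar (O ⧸ I) ℂ) :
    gaussMean I ψ (q.prod q' : QuadraticForm O (M × M')) = gaussMean I ψ q * gaussMean I ψ q' := by
  have := finite_quotient_smul_top M I
  have := finite_quotient_smul_top M' I
  unfold gaussMean
  rw [← mean_prod]
  refine gaussMean_eq_mean (AddMonoidHom.prodMap
    (Submodule.mkQ (I • ⊤ : Submodule O M)).toAddMonoidHom
    (Submodule.mkQ (I • ⊤ : Submodule O M')).toAddMonoidHom)
    (Function.Surjective.prodMap (Submodule.mkQ_surjective _) (Submodule.mkQ_surjective _))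
    _ fun x => ?_
  rw [QuadraticMap.prod_apply, map_add, AddChar.map_add_eq_mul]
  exact congrArg₂ (fun a b => ψ a * ψ b) (mk_quadraticForm_out I q x.1).symm
    (mk_quadraticForm_out I q' x.2).symm

/-- Nonvanishing is what permits cancelling a split-off rank-one summand. -/
theorem gaussMean_smul_sq_ne_zero (h2 : IsUnit (2 : O)) (ψ : AddChar (O ⧸ I) ℂ) (a : O) :
    gaussMean I ψ (a • QuadraticMap.sq (R := O)) ≠ 0 := by
  let := Fintype.ofFinite (O ⧸ I)
  rw [gaussMean_eq_mean (Ideal.Quotient.mk I).toAddMonoidHom Ideal.Quotient.mk_surjective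
    (fun r => ψ (Ideal.Quotient.mk I a * r ^ 2)) fun x => ?_, mean_eq]
  · refine div_ne_zero (sum_addChar_mul_sq_ne_zero ?_ ψ _) ?_
    · have := h2.map (Ideal.Quotient.mk I)
      rwa [map_ofNat] at this
    · exact_mod_cast Nat.card_pos.ne'
  · simp [pow_two]

/-- Fourier inversion: orthogonality of characters recovers from the means the proportion of points
where `f` takes the value `c`. -/
theorem sum_addChar_mul_mean {R : Type*} [AddCommGroup R] [Fintype R] [DecidableEq R]
    {G : Type*} [Fintype G] (c : R) (f : G → R) :
    ∑ ψ : AddChar R ℂ, ψ (-c) * mean (fun y => ψ (f y)) =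
      (∑ y, if f y = c then (Fintype.card R : ℂ) else 0) / Nat.card G := by
  have orth : ∀ r : R, ∑ ψ : AddChar R ℂ, ψ (-c) * ψ r =
      if r = c then (Fintype.card R : ℂ) else 0 := fun r => by
    simp_rw [← AddChar.map_add_eq_mul]
    rw [AddChar.sum_apply_eq_ite]
    refine if_congr ?_ rfl rfl
    rw [neg_add_eq_zero, eq_comm]
  simp_rw [mean_eq, mul_div_assoc', ← Finset.sum_div, Finset.mul_sum, ← orth]
  rw [Finset.sum_comm]

/-- Forms with equal Gauss means represent the same values modulo `I`. -/
theorem exists_sub_mem_of_gaussMean_eq {M' : Type*} [AddCommGroup M'] [Module O M']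
    [Module.Finite O M'] {q : QuadraticForm O M} {q' : QuadraticForm O M'}
    (h : ∀ ψ : AddChar (O ⧸ I) ℂ, gaussMean I ψ q = gaussMean I ψ q') (x : M) :
    ∃ x' : M', q x - q' x' ∈ I := by
  classical
  have := finite_quotient_smul_top M I
  have := finite_quotient_smul_top M' I
  let := Fintype.ofFinite (O ⧸ I)
  let := Fintype.ofFinite (M ⧸ (I • ⊤ : Submodule O M))
  let := Fintype.ofFinite (M' ⧸ (I • ⊤ : Submodule O M'))
  by_contra! hne
  set c := Ideal.Quotient.mk I (q x) with hc
  have h1 : ∑ ψ : AddChar (O ⧸ I) ℂ, ψ (-c) * gaussMean I ψ q =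
      ∑ ψ : AddChar (O ⧸ I) ℂ, ψ (-c) * gaussMean I ψ q' := by simp_rw [h]
  have h1 := (sum_addChar_mul_mean c fun y : M ⧸ (I • ⊤ : Submodule O M) =>
    Ideal.Quotient.mk I (q y.out)).symm.trans (h1.trans (sum_addChar_mul_mean c
      fun y : M' ⧸ (I • ⊤ : Submodule O M') => Ideal.Quotient.mk I (q' y.out)))
  have h0 : ∑ y : M' ⧸ (I • ⊤ : Submodule O M'), (if Ideal.Quotient.mk I (q' y.out) = c then
      (Fintype.card (O ⧸ I) : ℂ) else 0) = 0 := Finset.sum_eq_zero fun y _ => if_neg fun hy =>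
    hne y.out (by rw [← Ideal.Quotient.eq]; exact hy.symm)
  rw [h0, zero_div, div_eq_zero_iff, or_iff_left (by exact_mod_cast Nat.card_pos.ne')] at h1
  have h3 : ∑ y : M ⧸ (I • ⊤ : Submodule O M), (if Ideal.Quotient.mk I (q y.out) = c then
      Fintype.card (O ⧸ I) else 0) = 0 := by exact_mod_cast h1
  have h4 := (Finset.sum_eq_zero_iff.1 h3) (Submodule.mkQ (I • ⊤ : Submodule O M) x)
    (Finset.mem_univ _)
  rw [if_pos (mk_quadraticForm_out I q x)] at h4
  exact Fintype.card_ne_zero h4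

end GaussMean

/-! ### Orthogonal splitting and classification over a discrete valuation ring. -/

section Splitting

variable {O : Type*} [CommRing O] [IsDomain O] {M : Type*} [AddCommGroup M] [Module O M]

open QuadraticMap

/-- A vector whose value divides all other values splits off as an orthogonal summand. -/
theorem exists_equivalent_prod [IsPrincipalIdealRing O] [Module.Finite O M] [Module.Free O M]
    (h2 : IsUnit (2 : O)) (q : QuadraticForm O M) (hq : q.polarBilin.SeparatingLeft) {x₀ : M}
    (h0 : q x₀ ≠ 0) (hdvd : ∀ y, q x₀ ∣ q y) :
    ∃ N : Submodule O M, Module.finrank O N + 1 = Module.finrank O M ∧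
      ((q x₀ • sq (R := O)).prod (q.comp N.subtype)).Equivalent q ∧
      (polarBilin (q.comp N.subtype)).SeparatingLeft := by
  set a := q x₀ with ha
  have h2a : (2 : O) * a ≠ 0 := mul_ne_zero h2.ne_zero h0
  have hself : polar q x₀ x₀ = 2 * a := by rw [polar_self, nsmul_eq_mul, Nat.cast_ofNat]
  let N : Submodule O M := LinearMap.ker (q.polarBilin x₀)
  have hN : ∀ {y}, y ∈ N ↔ polar q x₀ y = 0 := LinearMap.mem_ker
  have hdec : ∀ y, ∃ c : O, y - c • x₀ ∈ N := by
    intro y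
    -- The orthogonal projection onto `x₀` has coefficient `polar q x₀ y / (2 a)`, which is integral
    -- by this divisibility.
    have : a ∣ polar q x₀ y := dvd_sub (dvd_sub (hdvd _) dvd_rfl) (hdvd _)
    obtain ⟨d, hd⟩ := this
    obtain ⟨w, hw⟩ := h2
    refine ⟨↑w⁻¹ * d, ?_⟩
    rw [hN, polar_sub_right, polar_smul_right, hself, hd, smul_eq_mul, ← hw]
    have : (w : O) * ↑w⁻¹ = 1 := Units.mul_inv w
    linear_combination (-a * d) * this
  let f : O × N →ₗ[O] M := (LinearMap.toSpanSingleton O M x₀).coprod N.subtype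
  have hf : ∀ c z, f (c, z) = c • x₀ + (z : M) := fun c z => by simp [f]
  have hinj : Function.Injective f := by
    rw [injective_iff_map_eq_zero]
    rintro ⟨c, z⟩ h
    rw [hf] at h
    have h1 : polar q x₀ (c • x₀ + (z : M)) = 0 := by rw [h, polar_zero_right]
    rw [polar_add_right, hN.1 z.2, add_zero, polar_smul_right, hself, smul_eq_mul] at h1
    have hc : c = 0 := (mul_eq_zero.1 h1).resolve_right h2a
    rw [hc, zero_smul, zero_add] at h
    ext
    · exact hc
    · exact h
  have hsurj : Function.Surjective f := fun y => by
    obtain ⟨c, hc⟩ := hdec y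
    exact ⟨(c, ⟨_, hc⟩), by rw [hf]; simp⟩
  let e : (O × N) ≃ₗ[O] M := LinearEquiv.ofBijective f ⟨hinj, hsurj⟩
  refine ⟨N, ?_, ⟨⟨e, ?_⟩⟩, ?_⟩
  · rw [← e.finrank_eq, Module.finrank_prod, Module.finrank_self, add_comm]
  · rintro ⟨c, z⟩
    change q (f (c, z)) = _
    rw [hf, QuadraticMap.map_add q, polar_smul_left, hN.1 z.2, QuadraticMap.map_smul]
    simp [← ha, mul_comm, mul_assoc]
  · intro z hz
    have : (z : M) = 0 := hq _ fun y => by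
      obtain ⟨c, hc⟩ := hdec y
      have h1 : polar q z (y - c • x₀) = 0 := hz ⟨_, hc⟩
      have h3 : polar q z x₀ = 0 := by rw [polar_comm]; exact hN.1 z.2
      rw [polar_sub_right, polar_smul_right, h3, smul_zero, sub_zero] at h1
      exact h1
    exact Subtype.ext this

/-- A value of least valuation divides all others; if it were zero the form would vanish
identically, against nondegeneracy. -/
theorem exists_ne_zero_forall_dvd [IsDiscreteValuationRing O] [Nontrivial M]
    (q : QuadraticForm O M) (hq : q.polarBilin.SeparatingLeft) :
    ∃ x₀, q x₀ ≠ 0 ∧ ∀ y, q x₀ ∣ q y := by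
  let f : M → ℕ∞ := fun x => IsDiscreteValuationRing.addVal O (q x)
  have hmin : ∀ y, q (Function.argmin f) ∣ q y := fun y =>
    (IsDiscreteValuationRing.addVal_le_iff_dvd).1 (Function.argmin_le f y)
  refine ⟨_, fun h0 => ?_, hmin⟩
  have hz : ∀ y, q y = 0 := fun y => by simpa [h0] using hmin y
  obtain ⟨x, hx⟩ := exists_ne (0 : M)
  exact hx (hq x fun y => by simp [polar, hz])

end Splitting

universe u v w

/-- Over a discrete valuation ring with invertible `2` in which all `1 + m` are squares,
nondegenerate forms with the same Gauss means are isometric. -/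
theorem equivalent_of_gaussMean_eq {O : Type u} [CommRing O] [IsDomain O]
    [IsDiscreteValuationRing O] (h2 : IsUnit (2 : O))
    (hsq : ∀ m ∈ IsLocalRing.maximalIdeal O, IsSquare (1 + m))
    (hfin : ∀ I : Ideal O, I ≠ ⊥ → Finite (O ⧸ I)) (n : ℕ) :
    ∀ (M : Type v) (M' : Type w) [AddCommGroup M] [Module O M] [Module.Finite O M]
      [Module.Free O M] [AddCommGroup M'] [Module O M'] [Module.Finite O M'] [Module.Free O M']
      (q : QuadraticForm O M) (q' : QuadraticForm O M'), q.polarBilin.SeparatingLeft →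
      q'.polarBilin.SeparatingLeft → Module.finrank O M = n →
      (∀ (I : Ideal O) [Finite (O ⧸ I)], I ≠ ⊥ → ∀ ψ : AddChar (O ⧸ I) ℂ,
        gaussMean I ψ q = gaussMean I ψ q') → q.Equivalent q' := by
  induction n with
  | zero =>
    intro M M' _ _ _ _ _ _ _ _ q q' hq hq' hn h
    have hM : Subsingleton M := Module.finrank_zero_iff.1 hn
    rcases subsingleton_or_nontrivial M' with hM' | hM'
    · exact ⟨⟨0, fun x => by simp [Subsingleton.elim x 0]⟩⟩
    · exfalso
      obtain ⟨x, hx, -⟩ := exists_ne_zero_forall_dvd q' hq'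
      -- The form on the zero module takes only the value `0`, while `q' x` is nonzero modulo `q' x`
      -- times the maximal ideal.
      let I := Ideal.span {q' x} * IsLocalRing.maximalIdeal O
      have hI : I ≠ ⊥ := mul_ne_zero (by simpa using hx) (IsDiscreteValuationRing.not_a_field O)
      have := hfin I hI
      obtain ⟨y, hy⟩ := exists_sub_mem_of_gaussMean_eq (fun ψ => (h I hI ψ).symm) x
      rw [Subsingleton.elim y 0, QuadraticMap.map_zero, sub_zero,
        Ideal.mem_span_singleton_mul] at hy
      obtain ⟨z, hz, hzx⟩ := hy
      have : z = 1 := mul_left_cancel₀ hx (by rw [hzx, mul_one])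
      exact (IsLocalRing.mem_maximalIdeal _).1 hz (this ▸ isUnit_one)
  | succ n ih =>
    intro M M' _ _ _ _ _ _ _ _ q q' hq hq' hn h
    have hM : Nontrivial M := Module.nontrivial_of_finrank_pos (R := O) (by omega)
    obtain ⟨x, hx, hdvd⟩ := exists_ne_zero_forall_dvd q hq
    have ha : Ideal.span {q x} ≠ ⊥ := by simpa using hx
    have hdvd' : ∀ y', q x ∣ q' y' := fun y' => by
      have := hfin _ ha
      obtain ⟨y, hy⟩ := exists_sub_mem_of_gaussMean_eq (fun ψ => (h _ ha ψ).symm) y'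
      rw [Ideal.mem_span_singleton] at hy
      exact (dvd_iff_dvd_of_dvd_sub hy).2 (hdvd y)
    obtain ⟨x', hx'⟩ : ∃ x', q' x' = q x := by
      -- Modulo this ideal one finds `q' y = q x (1 - z)` with `z` in the maximal ideal. Then `1 -
      -- z` is the square of a unit, and dividing `y` by that unit gives the exact value `q x`.
      have hI : Ideal.span {q x} * IsLocalRing.maximalIdeal O ≠ ⊥ :=
        mul_ne_zero ha (IsDiscreteValuationRing.not_a_field O)
      have := hfin _ hI
      obtain ⟨y, hy⟩ := exists_sub_mem_of_gaussMean_eq (fun ψ => h _ hI ψ) x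
      rw [Ideal.mem_span_singleton_mul] at hy
      obtain ⟨z, hz, hzx⟩ := hy
      obtain ⟨s, hs⟩ := hsq (-z) (neg_mem hz)
      have hunit : IsUnit (1 + -z) := by
        by_contra hu
        have := Ideal.add_mem _ ((IsLocalRing.mem_maximalIdeal _).2 hu) hz
        rw [neg_add_cancel_right] at this
        exact (IsLocalRing.mem_maximalIdeal _).1 this isUnit_one
      rw [hs] at hunit
      obtain ⟨t, ht⟩ := isUnit_of_mul_isUnit_left hunit
      refine ⟨(↑t⁻¹ : O) • y, ?_⟩
      have h1 : q' y = q x * (t * t) := by rw [ht, ← hs]; linear_combination hzx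
      have h3 : (t : O) * ↑t⁻¹ = 1 := Units.mul_inv t
      rw [QuadraticMap.map_smul, h1, smul_eq_mul]
      linear_combination (q x * (t * ↑t⁻¹ + 1)) * h3
    obtain ⟨N, hN, hNe, hNs⟩ := exists_equivalent_prod h2 q hq hx hdvd
    obtain ⟨N', hN', hNe', hNs'⟩ := exists_equivalent_prod h2 q' hq' (by rwa [hx'])
      (by rwa [hx'])
    rw [hx'] at hNe'
    have key : (q.comp N.subtype).Equivalent (q'.comp N'.subtype) := by
      refine ih N N' _ _ hNs hNs' (by omega) fun I _ hI ψ => ?_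
      have := h I hI ψ
      rw [← gaussMean_congr hNe, ← gaussMean_congr hNe', gaussMean_prod, gaussMean_prod] at this
      exact mul_left_cancel₀ (gaussMean_smul_sq_ne_zero h2 ψ _) this
    exact hNe.symm.trans (((QuadraticMap.Equivalent.refl _).prod key).trans hNe')

/-! ### Square roots and Cauchy–Schwarz in complete valued fields. -/

section Valued

open Filter Topology WithZero

variable {E : Type*} [Field E] [Valued E ℤᵐ⁰]

theorem exists_sub_valuation_le_of_denseRange {K : Type*} {f : K → E} (hf : DenseRange f) (x : E)
    {a : E} (ha : a ≠ 0) : ∃ y, Valued.v (f y - x) ≤ Valued.v a := by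
  have ha' : (Valued.v : Valuation E ℤᵐ⁰).restrict a ≠ 0 := by simpa using ha
  have hmem : {y : E | (Valued.v : Valuation E ℤᵐ⁰).restrict (y - x) <
      (Units.mk0 _ ha').1} ∈ 𝓝 x := Valued.mem_nhds.2 ⟨_, subset_rfl⟩
  obtain ⟨_, hy, y, rfl⟩ := mem_closure_iff_nhds.1 (hf x) _ hmem
  exact ⟨y, ((Valuation.restrict_lt_iff _).1 hy).le⟩

/-- In a complete valued field with residue characteristic different from `2`, the elements
`1 + m` with `v m < 1` are squares. -/
theorem exists_one_add_eq_mul_self [CompleteSpace E] (h2 : Valued.v (2 : E) = 1) {m : E}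
    (hm : Valued.v m < 1) : ∃ s : E, 1 + m = s * s := by
  have h20 : (2 : E) ≠ 0 := fun h => by simp [h] at h2
  -- A fixed point `y` of `f` satisfies `(1 + y)² = 1 + m`, and `f` contracts the ball `v y ≤ v m`.
  let f : E → E := fun y => (m - y ^ 2) / 2
  let x : ℕ → E := fun n => f^[n] 0
  have hx : ∀ n, x (n + 1) = f (x n) := fun n => Function.iterate_succ_apply' f n 0
  have hv : ∀ n, Valued.v (x n) ≤ Valued.v m := by
    intro n
    induction n with
    | zero => simp [x]
    | succ n ih =>
      rw [hx]
      simp only [f]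
      rw [map_div₀, h2, div_one]
      refine (Valuation.map_sub _ _ _).trans (max_le le_rfl ?_)
      rw [map_pow, pow_two]
      calc _ ≤ Valued.v m * 1 := mul_le_mul' ih (ih.trans hm.le)
        _ = _ := mul_one _
  have hd : ∀ n, Valued.v (x (n + 1) - x n) ≤ Valued.v m ^ n := by
    intro n
    induction n with
    | zero =>
      rw [pow_zero]
      exact (Valuation.map_sub _ _ _).trans (max_le ((hv _).trans hm.le) ((hv _).trans hm.le))
    | succ n ih =>
      have : x (n + 1 + 1) - x (n + 1) = -((x (n + 1) - x n) * (x (n + 1) + x n) / 2) := by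
        rw [hx (n + 1), hx n]
        simp only [f]
        field_simp
        ring
      rw [this, Valuation.map_neg, map_div₀, h2, div_one, map_mul, pow_succ]
      exact mul_le_mul' ih ((Valuation.map_add _ _ _).trans (max_le (hv _) (hv _)))
  have hd' : ∀ n k, Valued.v (x (n + k) - x n) ≤ Valued.v m ^ n := by
    intro n k
    induction k with
    | zero => simp
    | succ k ih =>
      rw [← sub_add_sub_cancel _ (x (n + k))]
      refine (Valuation.map_add _ _ _).trans (max_le ((hd _).trans ?_) ih)
      exact pow_le_pow_right_of_le_one' hm.le (Nat.le_add_right n k)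
  have hd'' : ∀ n a b, n ≤ a → n ≤ b → Valued.v (x b - x a) ≤ Valued.v m ^ n := by
    intro n a b ha hb
    obtain ⟨i, rfl⟩ := Nat.exists_eq_add_of_le ha
    obtain ⟨j, rfl⟩ := Nat.exists_eq_add_of_le hb
    rw [← sub_sub_sub_cancel_right _ _ (x n)]
    exact (Valuation.map_sub _ _ _).trans (max_le (hd' _ _) (hd' _ _))
  have hc : CauchySeq x := by
    refine Valued.cauchy_iff.2 ⟨inferInstance, fun γ => ?_⟩
    obtain ⟨n, hn⟩ := exists_pow_lt₀ hm (Units.map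
      (MonoidWithZeroHom.ValueGroup₀.embedding (f := .ofClass (Valued.v : Valuation E ℤᵐ⁰))) γ)
    refine ⟨x '' Set.Ici n, image_mem_map (Ici_mem_atTop n), ?_⟩
    rintro _ ⟨a, ha, rfl⟩ _ ⟨b, hb, rfl⟩
    rw [Valuation.restrict_lt_iff_lt_embedding]
    exact (hd'' n a b ha hb).trans_lt hn
  obtain ⟨l, hl⟩ := cauchySeq_tendsto_of_complete hc
  have hf : Continuous f := (continuous_const.sub (continuous_id.pow 2)).div_const 2
  have hfl : f l = l := by
    refine tendsto_nhds_unique ((hf.tendsto l).comp hl) ?_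
    refine ((tendsto_add_atTop_iff_nat 1).2 hl).congr fun n => ?_
    exact hx n
  refine ⟨1 + l, ?_⟩
  simp only [f] at hfl
  rw [div_eq_iff h20] at hfl
  linear_combination hfl

/-- A binary form over such a field with large polar value is isotropic. -/
theorem valuation_polar_sq_le [CompleteSpace E] (h2 : Valued.v (2 : E) = 1) {V : Type*}
    [AddCommGroup V] [Module E V] {Q : QuadraticForm E V} (hQ : Q.Anisotropic) (x y : V) :
    Valued.v (QuadraticMap.polar Q x y) ^ 2 ≤ Valued.v (Q x) * Valued.v (Q y) := by
  have h20 : (2 : E) ≠ 0 := fun h => by simp [h] at h2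
  by_contra! hlt
  set B := QuadraticMap.polar Q x y with hB
  have hB0 : B ≠ 0 := by
    rintro h
    simp [h] at hlt
  have hy0 : Q y ≠ 0 := fun h => hB0 (by rw [hB, hQ y h, QuadraticMap.polar_zero_right])
  -- The discriminant `B² - 4 Q(x) Q(y)` of `c ↦ Q (x + c y)` is `B²` times an element of `1 + m`,
  -- hence a square, and the polynomial has a root `c`.
  have h4 : Valued.v (-(4 * Q x * Q y) / B ^ 2) < 1 := by
    have hv : Valued.v (B ^ 2) ≠ 0 := by simpa using hB0
    rw [map_div₀, div_lt_one₀ (zero_lt_iff.2 hv), Valuation.map_neg,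
      show (4 : E) = 2 * 2 by norm_num, map_mul, map_mul, map_mul, h2, map_pow]
    simpa using hlt
  obtain ⟨s, hs⟩ := exists_one_add_eq_mul_self h2 h4
  have hs' : B ^ 2 - 4 * Q x * Q y = (B * s) ^ 2 := by
    rw [mul_pow, pow_two s, ← hs]
    field_simp
    ring
  set c := (-B + B * s) / (2 * Q y) with hc
  have hc' : c * (2 * Q y) = -B + B * s := div_mul_cancel₀ _ (mul_ne_zero h20 hy0)
  have hz : Q (x + c • y) = 0 := by
    rw [QuadraticMap.map_add Q, QuadraticMap.map_smul, QuadraticMap.polar_smul_right, ← hB,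
      smul_eq_mul, smul_eq_mul]
    have : 4 * Q y * (Q x + c * c * Q y + c * B) = 0 := by
      linear_combination (c * (2 * Q y) + (B + B * s)) * hc' - hs'
    exact (mul_eq_zero.1 this).resolve_left (mul_ne_zero
      (by rw [show (4 : E) = 2 * 2 by norm_num]; exact mul_ne_zero h20 h20) hy0)
  have hx : x = (-c) • y := by
    rw [neg_smul]
    exact eq_neg_of_add_eq_zero_left (hQ _ hz)
  have e1 : B = -c * (2 * Q y) := by
    rw [hB, hx, QuadraticMap.polar_smul_left, QuadraticMap.polar_self, smul_eq_mul, nsmul_eq_mul,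
      Nat.cast_ofNat]
  have e2 : Q x = c * c * Q y := by
    rw [hx, QuadraticMap.map_smul, smul_eq_mul, neg_mul_neg]
  -- Anisotropy has made `x` proportional to `y`, and then the inequality is an equality because `v
  -- 2 = 1`.
  refine hlt.ne' ?_
  rw [e1, e2]
  simp only [map_mul, Valuation.map_neg, h2, one_mul, sq]
  exact (mul_mul_mul_comm _ _ _ _).trans (mul_assoc _ _ _).symm

end Valued

/-! ### From isometries of coordinate lattices to isometries of quadratic spaces. -/

section Extension

variable {E : Type*} [Field E] {O : Type*} [CommRing O] [Algebra O E]

theorem constr_linearCombination {V V' : Type*} [AddCommGroup V] [Module E V] [Module O V]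
    [IsScalarTower O E V] [AddCommGroup V'] [Module E V'] [Module O V'] [IsScalarTower O E V']
    {κ : Type*} [Fintype κ] [DecidableEq κ] (b : Module.Basis κ E V) (u : (κ → O) →ₗ[O] V')
    (x : κ → O) :
    b.constr E (fun i => u (Pi.single i 1)) (Fintype.linearCombination O b x) = u x := by
  have : (b.constr E fun i => u (Pi.single i 1)).restrictScalars O ∘ₗ
      Fintype.linearCombination O b = u := by
    ext i
    simp [Fintype.linearCombination_apply_single]
  exact LinearMap.congr_fun this x

variable [IsDomain O] [IsFractionRing O E]

theorem exists_smul_eq_linearCombination {V : Type*} [AddCommGroup V] [Module E V] [Module O V]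
    [IsScalarTower O E V] {κ : Type*} [Fintype κ] (b : Module.Basis κ E V) (v : V) :
    ∃ a : O, a ≠ 0 ∧ ∃ x : κ → O, a • v = Fintype.linearCombination O b x := by
  obtain ⟨a, ha⟩ := IsLocalization.exist_integer_multiples_of_finite (nonZeroDivisors O)
    (fun i => b.repr v i)
  choose x hx using ha
  refine ⟨a, nonZeroDivisors.coe_ne_zero a, x, ?_⟩
  rw [Fintype.linearCombination_apply]
  conv_lhs => rw [← b.sum_repr v, Finset.smul_sum]
  refine Finset.sum_congr rfl fun i _ => ?_
  rw [← IsScalarTower.algebraMap_smul E (x i), hx, smul_assoc]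

/-- An isometry between integral coordinate lattices extends to the quadratic spaces they span. -/
theorem exists_isometryEquiv_of_basis {V V' : Type*} [AddCommGroup V] [Module E V] [Module O V]
    [IsScalarTower O E V] [AddCommGroup V'] [Module E V'] [Module O V'] [IsScalarTower O E V']
    {κ κ' : Type*} [Fintype κ] [Fintype κ'] (b : Module.Basis κ E V) (b' : Module.Basis κ' E V')
    {Q : QuadraticForm E V} {Q' : QuadraticForm E V'} {q : QuadraticForm O (κ → O)}
    {q' : QuadraticForm O (κ' → O)} {c : E} (hc : c ≠ 0)
    (hq : ∀ x, algebraMap O E (q x) = c * Q (Fintype.linearCombination O b x))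
    (hq' : ∀ x, algebraMap O E (q' x) = c * Q' (Fintype.linearCombination O b' x))
    (h : q.Equivalent q') :
    ∃ e : Q.IsometryEquiv Q', (fun x => e x) '' (Submodule.span O (Set.range b) : Set V) =
      (Submodule.span O (Set.range b') : Set V') := by
  classical
  obtain ⟨e⟩ := h
  let u : (κ → O) →ₗ[O] V' := Fintype.linearCombination O b' ∘ₗ e.toLinearEquiv.toLinearMap
  let u' : (κ' → O) →ₗ[O] V := Fintype.linearCombination O b ∘ₗ e.symm.toLinearEquiv.toLinearMap
  let f : V →ₗ[E] V' := b.constr E fun i => u (Pi.single i 1)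
  let g : V' →ₗ[E] V := b'.constr E fun i => u' (Pi.single i 1)
  have hf : ∀ x, f (Fintype.linearCombination O b x) = Fintype.linearCombination O b' (e x) :=
    constr_linearCombination b u
  have hg : ∀ x, g (Fintype.linearCombination O b' x) = Fintype.linearCombination O b (e.symm x) :=
    constr_linearCombination b' u'
  have hgf : g ∘ₗ f = LinearMap.id := b.ext fun i => by
    have hi : b i = Fintype.linearCombination O b (Pi.single i 1) := by
      rw [Fintype.linearCombination_apply_single, one_smul]
    rw [LinearMap.comp_apply, LinearMap.id_apply, hi, hf, hg, e.symm_apply_apply]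
  have hfg : f ∘ₗ g = LinearMap.id := b'.ext fun i => by
    have hi : b' i = Fintype.linearCombination O b' (Pi.single i 1) := by
      rw [Fintype.linearCombination_apply_single, one_smul]
    rw [LinearMap.comp_apply, LinearMap.id_apply, hi, hg, hf, e.apply_symm_apply]
  refine ⟨⟨LinearEquiv.ofLinearMap f g hfg hgf, fun v => ?_⟩, ?_⟩
  · change Q' (f v) = Q v
    -- Some nonzero multiple of `v` lies in the coordinate lattice; homogeneity removes the factor
    -- `a²`.
    obtain ⟨a, ha, x, hx⟩ := exists_smul_eq_linearCombination (O := O) b v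
    have ha' : algebraMap O E a ≠ 0 := by
      simpa using (FaithfulSMul.algebraMap_injective O E).ne ha
    rw [← IsScalarTower.algebraMap_smul E a v] at hx
    have h1 := hq x
    rw [← e.map_app x, hq', ← hf, ← hx, map_smul, QuadraticMap.map_smul, QuadraticMap.map_smul]
      at h1
    exact smul_right_injective _ (mul_ne_zero ha' ha') (mul_left_cancel₀ hc h1)
  · rw [← Fintype.range_linearCombination, ← Fintype.range_linearCombination]
    ext v
    constructor
    · rintro ⟨_, ⟨x, rfl⟩, rfl⟩
      exact ⟨e x, (hf x).symm⟩
    · rintro ⟨x, rfl⟩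
      exact ⟨_, ⟨e.symm x, rfl⟩, (hf _).trans (by rw [e.apply_symm_apply])⟩

end Extension

/-! ### Local coordinate forms and their sampling by finite groups of global vectors. -/

section LocalForm

variable {K E O : Type*} [Field K] [Invertible (2 : K)] [Field E] [Algebra K E] [CommRing O]
  [Algebra O E] {W : Type*} [AddCommGroup W] [Module K W] {κ : Type*} [Fintype κ]

/-- `q` is the restriction of `c Q` to the `O`-lattice with basis `b`, in coordinates. -/
def IsLocalForm (b : Module.Basis κ K W) (Q : QuadraticForm K W) (c : K)
    (q : QuadraticForm O (κ → O)) : Prop :=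
  ∀ x, algebraMap O E (q x) = algebraMap K E c *
    Q.baseChange E (Fintype.linearCombination O (b.baseChange E) x)

/-- The finite group `S` consists of vectors with integral coordinates, and represents all classes
of coordinate vectors modulo `I`. -/
def IsSampling (E : Type*) [Field E] [Algebra K E] [Algebra O E] (b : Module.Basis κ K W)
    (I : Ideal O) (S : AddSubgroup W) : Prop :=
  (∀ w ∈ S, ∃ x : κ → O, ∀ i, algebraMap O E (x i) = algebraMap K E (b.repr w i)) ∧
    ∀ x : κ → O, ∃ w ∈ S, ∃ y : κ → O, (∀ i, y i ∈ I) ∧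
      ∀ i, algebraMap O E (x i + y i) = algebraMap K E (b.repr w i)

theorem exists_isLocalForm (b : Module.Basis κ K W) (Q : QuadraticForm K W) (c : K)
    (h : ∀ i j, ∃ o : O, algebraMap O E o =
      algebraMap K E (c * QuadraticMap.associated (R := K) Q (b i) (b j))) :
    ∃ q : QuadraticForm O (κ → O), IsLocalForm (E := E) b Q c q := by
  classical
  let : Invertible (2 : E) := (Invertible.map (algebraMap K E) 2).copy 2 (map_ofNat _ _).symm
  choose M hM using h
  refine ⟨(Matrix.toBilin' (Matrix.of M)).toQuadraticMap, fun x => ?_⟩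
  have hx : Fintype.linearCombination O (b.baseChange E) x =
      ∑ i, algebraMap O E (x i) ⊗ₜ[K] b i := by
    rw [Fintype.linearCombination_apply]
    refine Finset.sum_congr rfl fun i _ => ?_
    rw [Module.Basis.baseChange_apply, TensorProduct.smul_tmul', Algebra.algebraMap_eq_smul_one]
  rw [LinearMap.BilinMap.toQuadraticMap_apply, Matrix.toBilin'_apply,
    ← QuadraticMap.associated_eq_self_apply E (Q.baseChange E),
    QuadraticForm.associated_baseChange, hx]
  simp only [map_sum, LinearMap.sum_apply, map_mul, Finset.mul_sum, Matrix.of_apply, hM,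
    LinearMap.BilinForm.baseChange_tmul, Algebra.smul_def]
  rw [Finset.sum_comm]
  refine Finset.sum_congr rfl fun i _ => Finset.sum_congr rfl fun j _ => ?_
  ring

theorem IsLocalForm.algebraMap_eq {b : Module.Basis κ K W} {Q : QuadraticForm K W} {c : K}
    {q : QuadraticForm O (κ → O)} (hq : IsLocalForm (E := E) b Q c q) {x : κ → O} {w : W}
    (hx : ∀ i, algebraMap O E (x i) = algebraMap K E (b.repr w i)) :
    algebraMap O E (q x) = algebraMap K E (c * Q w) := by
  have : Fintype.linearCombination O (b.baseChange E) x = (1 : E) ⊗ₜ[K] w := by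
    rw [Fintype.linearCombination_apply]
    conv_rhs => rw [← b.sum_repr w, TensorProduct.tmul_sum]
    refine Finset.sum_congr rfl fun i _ => ?_
    rw [← IsScalarTower.algebraMap_smul E (x i), hx, Module.Basis.baseChange_apply,
      TensorProduct.tmul_smul, algebraMap_smul]
  rw [hq, this, QuadraticForm.baseChange_tmul, mul_one, map_mul, Algebra.smul_def, mul_one]

theorem IsLocalForm.algebraMap_polar {b : Module.Basis κ K W} {Q : QuadraticForm K W} {c : K}
    {q : QuadraticForm O (κ → O)} (hq : IsLocalForm (E := E) b Q c q) (x y : κ → O) :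
    algebraMap O E (QuadraticMap.polar q x y) = algebraMap K E c * QuadraticMap.polar
      (Q.baseChange E) (Fintype.linearCombination O (b.baseChange E) x)
      (Fintype.linearCombination O (b.baseChange E) y) := by
  simp only [QuadraticMap.polar, map_sub, hq _, map_add, mul_sub]

-- The right-hand side involves `S` only through the values `Q w`, so a bijection preserving values
-- preserves it even if it is not additive. The default `0` is never used, since sampled vectors
-- have integral coordinates.
open scoped Classical in
theorem IsLocalForm.gaussMean_eq [FaithfulSMul O E] {b : Module.Basis κ K W} {Q : QuadraticForm K W}
    {c : K} {q : QuadraticForm O (κ → O)} (hq : IsLocalForm (E := E) b Q c q) {I : Ideal O}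
    [Finite (O ⧸ I)] (ψ : AddChar (O ⧸ I) ℂ) {S : AddSubgroup W} [Finite S]
    (hS : IsSampling E b I S) :
    gaussMean I ψ q = mean fun w : S =>
      if H : ∃ o : O, algebraMap O E o = algebraMap K E (c * Q w) then
        ψ (Ideal.Quotient.mk I H.choose) else 0 := by
  have hinj := FaithfulSMul.algebraMap_injective O E
  choose x hx using fun w : S => hS.1 w w.2
  let f : S →+ (κ → O) :=
    { toFun := x
      map_zero' := funext fun i => hinj (by rw [hx]; simp)
      map_add' := fun u v => funext fun i => hinj (by rw [hx]; simp [hx]) }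
  have := finite_quotient_smul_top (κ → O) I
  have hsurj : Function.Surjective
      ((Submodule.mkQ (I • ⊤ : Submodule O (κ → O))).toAddMonoidHom.comp f) := by
    intro z
    obtain ⟨z, rfl⟩ := Submodule.mkQ_surjective _ z
    obtain ⟨w, hw, y, hy, hwy⟩ := hS.2 z
    refine ⟨⟨w, hw⟩, ?_⟩
    change Submodule.mkQ _ (x ⟨w, hw⟩) = _
    have hxy : x ⟨w, hw⟩ = z + y := funext fun i => hinj (by rw [hx, ← hwy]; rfl)
    rw [hxy, map_add, add_eq_left, Submodule.mkQ_apply, Submodule.Quotient.mk_eq_zero,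
      pi_eq_sum_univ' y]
    exact Submodule.sum_mem _ fun i _ => Submodule.smul_mem_smul (hy i) trivial
  unfold gaussMean
  rw [← mean_comp _ hsurj]
  congr 1
  funext w
  have hw : algebraMap O E (q (x w)) = algebraMap K E (c * Q w) := hq.algebraMap_eq (hx w)
  have H : ∃ o : O, algebraMap O E o = algebraMap K E (c * Q w) := ⟨_, hw⟩
  rw [dif_pos H, hinj (H.choose_spec.trans hw.symm)]
  exact congrArg ψ (mk_quadraticForm_out I q (x w))

variable (E) in
/-- An anisotropic form stays nondegenerate over every extension field. -/
theorem separatingLeft_baseChange [Module.Finite K W] {Q : QuadraticForm K W}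
    (hQ : Q.Anisotropic) : (Q.baseChange E).polarBilin.SeparatingLeft := by
  let : Invertible (2 : E) := (Invertible.map (algebraMap K E) 2).copy 2 (map_ofNat _ _).symm
  -- An orthogonal basis over `K` remains one over `E`, and its diagonal values remain nonzero.
  obtain ⟨v, hv⟩ := LinearMap.BilinForm.exists_orthogonal_basis
    (B := QuadraticMap.associated (R := K) Q) ⟨QuadraticMap.associated_isSymm K Q⟩
  intro x hx
  rw [← (v.baseChange E).sum_repr x]
  refine Finset.sum_eq_zero fun j _ => ?_
  have h1 := hx ((1 : E) ⊗ₜ v j)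
  rw [← (v.baseChange E).sum_repr x, QuadraticForm.polarBilin_baseChange] at h1
  simp only [Module.Basis.baseChange_apply, map_sum, LinearMap.sum_apply, TensorProduct.smul_tmul',
    LinearMap.BilinForm.baseChange_tmul] at h1
  rw [Finset.sum_eq_single j (fun i _ hij => ?_) (by simp)] at h1
  · have h2 : QuadraticMap.polar Q (v j) (v j) ≠ 0 := by
      rw [QuadraticMap.polar_self, nsmul_eq_mul]
      exact mul_ne_zero (Invertible.ne_zero _) fun h => v.ne_zero j (hQ _ h)
    rw [QuadraticMap.polarBilin_apply_apply, Algebra.smul_def] at h1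
    have := (mul_eq_zero.1 h1).resolve_left (by simpa using h2)
    simp at this
    simp [this]
  · rw [QuadraticMap.polarBilin_apply_apply,
      QuadraticMap.IsOrtho.polar_eq_zero (QuadraticMap.associated_isOrtho.1 (hv hij)), zero_smul]

theorem IsLocalForm.separatingLeft [FaithfulSMul O E] {b : Module.Basis κ K W}
    {Q : QuadraticForm K W} {c : K} (hc : c ≠ 0) {q : QuadraticForm O (κ → O)}
    (hQ : (Q.baseChange E).polarBilin.SeparatingLeft) (hq : IsLocalForm (E := E) b Q c q) :
    q.polarBilin.SeparatingLeft := by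
  classical
  have hinj := FaithfulSMul.algebraMap_injective O E
  intro x hx
  have h0 : Fintype.linearCombination O (b.baseChange E) x = 0 := by
    refine hQ _ fun z => ?_
    have : (Q.baseChange E).polarBilin (Fintype.linearCombination O (b.baseChange E) x) = 0 := by
      refine (b.baseChange E).ext fun i => ?_
      have h1 := hq.algebraMap_polar x (Pi.single i 1)
      rw [Fintype.linearCombination_apply_single, one_smul,
        show QuadraticMap.polar q x (Pi.single i 1) = 0 from hx _, map_zero] at h1
      exact (mul_eq_zero.1 h1.symm).resolve_left (by simpa using hc)
    rw [this, LinearMap.zero_apply]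
  funext i
  rw [Fintype.linearCombination_apply] at h0
  refine hinj ?_
  simp_rw [← IsScalarTower.algebraMap_smul E (x _)] at h0
  rw [Pi.zero_apply, map_zero]
  exact Fintype.linearIndependent_iff.1 (b.baseChange E).linearIndependent _ h0 i

end LocalForm

theorem mean_equiv {G H : Type*} [Finite G] [Finite H] (e : G ≃ H) (g : H → ℂ) :
    mean (fun x => g (e x)) = mean g := by
  let := Fintype.ofFinite G
  let := Fintype.ofFinite H
  rw [mean_eq, mean_eq, Equiv.sum_comp e, Nat.card_congr e]

/-- Lattices with matching finite samples have isometric localizations. -/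
theorem equivalent_of_isSampling {K E O : Type*} [Field K] [Invertible (2 : K)] [Field E]
    [Algebra K E] [CommRing O] [IsDomain O] [IsDiscreteValuationRing O] [Algebra O E]
    [FaithfulSMul O E] (h2 : IsUnit (2 : O))
    (hsq : ∀ m ∈ IsLocalRing.maximalIdeal O, IsSquare (1 + m))
    (hfin : ∀ I : Ideal O, I ≠ ⊥ → Finite (O ⧸ I))
    {W W' : Type*} [AddCommGroup W] [Module K W] [AddCommGroup W'] [Module K W']
    {κ κ' : Type*} [Fintype κ] [Fintype κ'] {b : Module.Basis κ K W} {b' : Module.Basis κ' K W'}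
    {Q : QuadraticForm K W} {Q' : QuadraticForm K W'} (hQ : Q.Anisotropic) (hQ' : Q'.Anisotropic)
    {c : K} (hc : c ≠ 0) {q : QuadraticForm O (κ → O)} {q' : QuadraticForm O (κ' → O)}
    (hq : IsLocalForm (E := E) b Q c q) (hq' : IsLocalForm (E := E) b' Q' c q')
    (hS : ∀ I : Ideal O, I ≠ ⊥ → ∃ (S : AddSubgroup W) (S' : AddSubgroup W') (e : S ≃ S'),
      Finite S ∧ (∀ w : S, Q' (e w) = Q w) ∧ IsSampling E b I S ∧ IsSampling E b' I S') :
    q.Equivalent q' := by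
  classical
  have := Module.Basis.finiteDimensional_of_finite b
  have := Module.Basis.finiteDimensional_of_finite b'
  refine equivalent_of_gaussMean_eq h2 hsq hfin _ _ _ q q'
    (hq.separatingLeft hc (separatingLeft_baseChange E hQ))
    (hq'.separatingLeft hc (separatingLeft_baseChange E hQ')) rfl fun I _ hI ψ => ?_
  obtain ⟨S, S', e, hfS, he, h, h'⟩ := hS I hI
  have : Finite S' := Finite.of_equiv _ e
  rw [hq.gaussMean_eq ψ h, hq'.gaussMean_eq ψ h', ← mean_equiv e]
  simp_rw [he]

open WithZero

/-! ### The valuation at infinity and definite forms. -/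

section Infinity

variable (F : Type*) [Field F]

open scoped Classical in
/-- The valuation at infinity of `F(t)`. -/
noncomputable abbrev inftyVal : Valuation (RatFunc F) ℤᵐ⁰ := RatFunc.inftyValuation F

attribute [-instance] RatFunc.valuedRatFunc

variable {F}

open scoped Classical RatFunc.CompletionAtInfty in
theorem valued_algebraMap_KInfty (x : RatFunc F) :
    Valued.v (algebraMap (RatFunc F) (KInfty F) x) = inftyVal F x :=
  letI := RatFunc.inftyValued F
  Valued.valuedCompletion_apply (K := RatFunc F) x

open scoped Classical RatFunc.CompletionAtInfty in
theorem denseRange_algebraMap_KInfty : DenseRange (algebraMap (RatFunc F) (KInfty F)) :=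
  UniformSpace.Completion.denseRange_coe (α := RatFunc F)

open scoped Classical RatFunc.CompletionAtInfty in
instance : CompleteSpace (KInfty F) :=
  inferInstanceAs (CompleteSpace (UniformSpace.Completion (RatFunc F)))

theorem inftyVal_algebraMap_C {a : F} (ha : a ≠ 0) : inftyVal F (RatFunc.C a) = 1 := by
  classical
  exact RatFunc.inftyValuation.C F ha

theorem inftyVal_two [NeZero (2 : F)] : inftyVal F 2 = 1 := by
  rw [← map_ofNat (RatFunc.C (K := F)) 2]
  exact inftyVal_algebraMap_C (NeZero.ne _)

theorem valued_two_KInfty [NeZero (2 : F)] : Valued.v (2 : KInfty F) = 1 := by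
  rw [← map_ofNat (algebraMap (RatFunc F) (KInfty F)) 2, valued_algebraMap_KInfty, inftyVal_two]

theorem inftyVal_X_zpow (m : ℤ) : inftyVal F (RatFunc.X ^ m) = exp m := by
  classical
  exact RatFunc.inftyValuation.X_zpow F m

theorem inftyVal_algebraMap {f : F[X]} (hf : f ≠ 0) :
    inftyVal F (algebraMap F[X] (RatFunc F) f) = exp (f.natDegree : ℤ) := by
  classical
  exact RatFunc.inftyValuation.polynomial F hf

theorem inftyVal_algebraMap_le_iff {f : F[X]} {n : ℕ} :
    inftyVal F (algebraMap F[X] (RatFunc F) f) ≤ exp (n : ℤ) ↔ f.natDegree ≤ n := by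
  rcases eq_or_ne f 0 with rfl | hf
  · simp
  · rw [inftyVal_algebraMap hf, exp_le_exp, Nat.cast_le]

end Infinity

section Definite

variable {F : Type*} [Field F] [NeZero (2 : F)] {W : Type*} [AddCommGroup W]
  [Module (RatFunc F) W] {Q : QuadraticForm (RatFunc F) W}

theorem atInfty_one_tmul (w : W) :
    atInfty Q ((1 : KInfty F) ⊗ₜ w) = algebraMap (RatFunc F) (KInfty F) (Q w) := by
  rw [QuadraticForm.baseChange_tmul, mul_one, Algebra.smul_def, mul_one]

theorem IsDefinite.anisotropic (hQ : IsDefinite Q) : Q.Anisotropic := fun w hw => by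
  have h := hQ ((1 : KInfty F) ⊗ₜ w) (by rw [atInfty_one_tmul, hw, map_zero])
  by_contra h0
  let b := Module.Basis.ofVectorSpace (RatFunc F) W
  obtain ⟨i, hi⟩ : ∃ i, b.repr w i ≠ 0 := by
    by_contra! hall
    exact h0 (b.repr.map_eq_zero_iff.1 (Finsupp.ext hall))
  have := b.baseChange_repr_tmul (S := KInfty F) 1 w i
  rw [h, map_zero, Finsupp.zero_apply, eq_comm, Algebra.smul_def, mul_one] at this
  exact hi (by simpa using this)

/-- This Cauchy–Schwarz inequality makes `w ↦ v_∞ (Q w)` ultrametric, so that balls are groups. -/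
theorem IsDefinite.polar_sq_le (hQ : IsDefinite Q) (x y : W) :
    inftyVal F (QuadraticMap.polar Q x y) ^ 2 ≤ inftyVal F (Q x) * inftyVal F (Q y) := by
  have h := valuation_polar_sq_le valued_two_KInfty hQ ((1 : KInfty F) ⊗ₜ x) (1 ⊗ₜ y)
  simp only [QuadraticMap.polar, ← TensorProduct.tmul_add, atInfty_one_tmul, ← map_sub,
    valued_algebraMap_KInfty] at h
  exact h

theorem IsDefinite.polar_le (hQ : IsDefinite Q) {x y : W} {γ : ℤᵐ⁰} (hx : inftyVal F (Q x) ≤ γ)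
    (hy : inftyVal F (Q y) ≤ γ) : inftyVal F (QuadraticMap.polar Q x y) ≤ γ := by
  refine le_of_not_gt fun h => ?_
  have h1 := (hQ.polar_sq_le x y).trans (mul_le_mul' hx hy)
  rw [← sq] at h1
  exact absurd (lt_of_lt_of_le (pow_lt_pow_left₀ h zero_le two_ne_zero) h1) (lt_irrefl _)

theorem IsDefinite.add_le (hQ : IsDefinite Q) {x y : W} {γ : ℤᵐ⁰} (hx : inftyVal F (Q x) ≤ γ)
    (hy : inftyVal F (Q y) ≤ γ) : inftyVal F (Q (x + y)) ≤ γ := by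
  rw [QuadraticMap.map_add Q]
  exact (Valuation.map_add _ _ _).trans (max_le ((Valuation.map_add _ _ _).trans (max_le hx hy))
    (hQ.polar_le hx hy))

/-- The vectors `w` with `v_∞ (Q w) ≤ γ` form a group if `Q` is definite. -/
def IsDefinite.ball (hQ : IsDefinite Q) (γ : ℤᵐ⁰) : AddSubgroup W where
  carrier := {w | inftyVal F (Q w) ≤ γ}
  zero_mem' := by simp
  add_mem' := hQ.add_le
  neg_mem' := by simp

theorem IsDefinite.mem_ball {hQ : IsDefinite Q} {γ : ℤᵐ⁰} {w : W} :
    w ∈ hQ.ball γ ↔ inftyVal F (Q w) ≤ γ := Iff.rfl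

/-- By orthogonality `x + y` and `x - y` have the same value, and their sum is `2 x`, where `2` is a
unit at infinity. -/
theorem IsDefinite.le_of_isOrtho (hQ : IsDefinite Q) {x y : W} (h : Q.IsOrtho x y) :
    inftyVal F (Q x) ≤ inftyVal F (Q (x + y)) := by
  have h1 : Q (x - y) = Q (x + y) := by
    rw [sub_eq_add_neg, QuadraticMap.map_add Q, QuadraticMap.map_add Q,
      QuadraticMap.polar_neg_right, h.polar_eq_zero, QuadraticMap.map_neg]
    simp
  have h2 := hQ.add_le (le_refl (inftyVal F (Q (x + y)))) (le_of_eq (by rw [h1]) :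
    inftyVal F (Q (x - y)) ≤ inftyVal F (Q (x + y)))
  have h3 : x + y + (x - y) = (2 : RatFunc F) • x := by rw [two_smul]; abel
  rwa [h3, QuadraticMap.map_smul, smul_eq_mul, map_mul, map_mul, inftyVal_two, one_mul,
    one_mul] at h2

/-- A definite form has an orthogonal basis with values of degree `0` or `-1`, and such a basis is
orthogonal for the valuation at infinity. -/
theorem IsDefinite.exists_basis [Module.Finite (RatFunc F) W] (hQ : IsDefinite Q) :
    ∃ e : Module.Basis (Fin (Module.finrank (RatFunc F) W)) (RatFunc F) W,
      (∀ i, inftyVal F (Q (e i)) ≤ 1 ∧ exp (-1) ≤ inftyVal F (Q (e i))) ∧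
      ∀ w i, inftyVal F (e.repr w i) ^ 2 * inftyVal F (Q (e i)) ≤ inftyVal F (Q w) := by
  obtain ⟨v, hv⟩ := LinearMap.BilinForm.exists_orthogonal_basis
    (B := QuadraticMap.associated (R := RatFunc F) Q)
    ⟨QuadraticMap.associated_isSymm (RatFunc F) Q⟩
  have hortho : ∀ i j, i ≠ j → Q.IsOrtho (v i) (v j) := fun i j hij =>
    QuadraticMap.associated_isOrtho.1 (hv hij)
  have hne : ∀ i, inftyVal F (Q (v i)) ≠ 0 := fun i => by
    rw [Valuation.ne_zero_iff]
    exact fun h => v.ne_zero i (hQ.anisotropic _ h)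
  choose m hm using fun i => show ∃ m : ℤ,
      inftyVal F (RatFunc.X ^ m) ^ 2 * inftyVal F (Q (v i)) ≤ 1 ∧
      exp (-1) ≤ inftyVal F (RatFunc.X ^ m) ^ 2 * inftyVal F (Q (v i)) by
    -- Scaling a vector by `t^m` shifts the degree of its value by `2 m`; rounding down brings it to
    -- `0` or `-1`.
    refine ⟨-((log (inftyVal F (Q (v i))) + 1) / 2), ?_⟩
    rw [inftyVal_X_zpow, ← exp_log (hne i), ← exp_nsmul, ← exp_add, ← exp_zero, exp_le_exp,
      exp_le_exp, log_exp]
    simp only [nsmul_eq_mul, Nat.cast_ofNat]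
    omega
  have hX : ∀ m : ℤ, IsUnit (RatFunc.X ^ m : RatFunc F) := fun m =>
    (zpow_ne_zero _ RatFunc.X_ne_zero).isUnit
  have hval : ∀ (c : RatFunc F) (w : W), inftyVal F (Q (c • w)) =
      inftyVal F c ^ 2 * inftyVal F (Q w) := fun c w => by
    rw [QuadraticMap.map_smul, smul_eq_mul, map_mul, map_mul, sq]
  let e := v.isUnitSMul fun i => hX (m i)
  have he : ∀ i, e i = RatFunc.X ^ m i • v i := fun i => v.isUnitSMul_apply _ i
  refine ⟨e, fun i => ?_, fun w i => ?_⟩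
  · rw [he, hval]
    exact hm i
  · rw [← hval]
    have hsum : w = e.repr w i • e i + ∑ j ∈ Finset.univ.erase i, e.repr w j • e j :=
      ((Finset.add_sum_erase _ (fun j => e.repr w j • e j) (Finset.mem_univ i)).trans
        (e.sum_repr w)).symm
    conv_rhs => rw [hsum]
    refine hQ.le_of_isOrtho ?_
    rw [← QuadraticMap.isOrtho_polarBilin, map_sum]
    refine Finset.sum_eq_zero fun j hj => ?_
    rw [he, he, QuadraticMap.polarBilin_apply_apply, QuadraticMap.polar_smul_left,
      QuadraticMap.polar_smul_left, QuadraticMap.polar_smul_right, QuadraticMap.polar_smul_right,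
      (hortho i j (Finset.ne_of_mem_erase hj).symm).polar_eq_zero]
    simp

end Definite

/-- The change of basis between two bases has a common denominator. -/
theorem exists_common_denominator {A K W κ κ' : Type*} [CommRing A] [IsDomain A] [Field K]
    [Algebra A K] [IsFractionRing A K] [AddCommGroup W] [Module K W] [Finite κ] [Finite κ']
    (b : Module.Basis κ K W) (e : Module.Basis κ' K W) :
    ∃ g : A, g ≠ 0 ∧ ∀ j i, ∃ a : A, algebraMap A K a = algebraMap A K g * e.repr (b j) i := by
  obtain ⟨a, ha⟩ := IsLocalization.exist_integer_multiples_of_finite (nonZeroDivisors A)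
    (fun p : κ × κ' => e.repr (b p.1) p.2)
  refine ⟨a, nonZeroDivisors.coe_ne_zero a, fun j i => ?_⟩
  obtain ⟨x, hx⟩ := ha (j, i)
  exact ⟨x, hx.trans (Algebra.smul_def _ _)⟩

theorem finite_natDegree_le (F : Type*) [Field F] [Finite F] (n : ℕ) :
    Finite {f : F[X] // f.natDegree ≤ n} := by
  have : Finite (Polynomial.degreeLT F (n + 1)) :=
    Finite.of_equiv _ (Polynomial.degreeLTEquiv F (n + 1)).symm.toEquiv
  refine Finite.of_injective (fun f => (⟨f.1, ?_⟩ : Polynomial.degreeLT F (n + 1)))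
    fun f g h => Subtype.ext (by simpa using h)
  rw [Polynomial.mem_degreeLT]
  exact (Polynomial.degree_le_of_natDegree_le f.2).trans_lt (by exact_mod_cast Nat.lt_succ_self n)

/-- In degrees, `2 deg x - 1 ≤ 2 N` forces `deg x ≤ N` by integrality. This is why the balls have
even radius and the basis values have degree at least `-1`. -/
theorem le_exp_of_sq_mul_le {x t : ℤᵐ⁰} {N : ℤ} (ht : exp (-1) ≤ t) (h : x ^ 2 * t ≤ exp (2 * N)) :
    x ≤ exp N := by
  rcases eq_or_ne x 0 with rfl | hx
  · exact zero_le
  · have h1 := (mul_le_mul' (le_refl (x ^ 2)) ht).trans h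
    rw [← exp_log hx, ← exp_nsmul, ← exp_add, exp_le_exp] at h1
    rw [← exp_log hx, exp_le_exp]
    simp only [nsmul_eq_mul, Nat.cast_ofNat] at h1
    omega

theorem exists_le_exp_two_mul (x : ℤᵐ⁰) : ∃ N : ℕ, x ≤ exp (2 * N : ℤ) := by
  rcases eq_or_ne x 0 with rfl | hx
  · exact ⟨0, zero_le⟩
  · refine ⟨(log x).toNat, ?_⟩
    rw [← exp_log hx, exp_le_exp, log_exp]
    omega

/-! ### Finite balls in definite lattices and the bijections given by isospectrality. -/

section Lattice

variable {F : Type*} [Field F] {W : Type*} [AddCommGroup W]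
  [Module (RatFunc F) W] [Module F[X] W]
  {L : Submodule F[X] W}

section

variable [NeZero (2 : F)] {Q : QuadraticForm (RatFunc F) W}

/-- The vectors of `L` with values of degree at most `2 N`. -/
noncomputable def IsDefinite.latticeBall (hQ : IsDefinite Q) (L : Submodule F[X] W) (N : ℕ) :
    AddSubgroup W :=
  L.toAddSubgroup ⊓ hQ.ball (exp (2 * N : ℤ))

theorem IsDefinite.mem_latticeBall {hQ : IsDefinite Q} {N : ℕ} {w : W} :
    w ∈ hQ.latticeBall L N ↔ w ∈ L ∧ inftyVal F (Q w) ≤ exp (2 * N : ℤ) := Iff.rfl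

theorem IsDefinite.latticeBall_mono (hQ : IsDefinite Q) {M N : ℕ} (h : M ≤ N) :
    hQ.latticeBall L M ≤ hQ.latticeBall L N := fun w hw =>
  ⟨hw.1, (IsDefinite.mem_latticeBall.1 hw).2.trans (exp_le_exp.2 (by omega))⟩

end

variable [IsScalarTower F[X] (RatFunc F) W]

theorem exists_finite_basis (L : Submodule F[X] W) [Submodule.IsLattice (RatFunc F) L] :
    ∃ (n : ℕ), Nonempty (Module.Basis (Fin n) F[X] L) :=
  ⟨_, ⟨Module.finBasis F[X] L⟩⟩

theorem extendOfIsLattice_repr [Submodule.IsLattice (RatFunc F) L] {κ : Type*}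
    (b : Module.Basis κ F[X] L) (v : L) (i : κ) :
    (b.extendOfIsLattice (RatFunc F)).repr v i = algebraMap F[X] (RatFunc F) (b.repr v i) := by
  have h : ∀ x : κ →₀ F[X], (b.extendOfIsLattice (RatFunc F)).repr (b.repr.symm x : L) i =
      algebraMap F[X] (RatFunc F) (x i) := by
    intro x
    induction x using Finsupp.induction_linear with
    | zero => simp
    | add x y hx hy => rw [map_add, Submodule.coe_add, map_add, Finsupp.add_apply, hx, hy]; simp
    | single j a =>
      rw [b.repr_symm_single, Submodule.coe_smul, ← b.extendOfIsLattice_apply (RatFunc F),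
        ← IsScalarTower.algebraMap_smul (RatFunc F) a, map_smul, Module.Basis.repr_self,
        Finsupp.smul_single, smul_eq_mul, mul_one]
      classical
      rw [Finsupp.single_apply, Finsupp.single_apply]
      split_ifs <;> simp
  have := h (b.repr v)
  rwa [LinearEquiv.symm_apply_apply] at this

theorem module_finite_of_isLattice (L : Submodule F[X] W) [Submodule.IsLattice (RatFunc F) L] :
    Module.Finite (RatFunc F) W :=
  let ⟨_, ⟨b⟩⟩ := exists_finite_basis L
  Module.Basis.finiteDimensional_of_finite (b.extendOfIsLattice (RatFunc F))

theorem exists_denominator_repr (L : Submodule F[X] W) [Submodule.IsLattice (RatFunc F) L]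
    {κ : Type*} [Finite κ] (e : Module.Basis κ (RatFunc F) W) :
    ∃ g : F[X], g ≠ 0 ∧ ∀ v ∈ L, ∀ i, ∃ a : F[X], algebraMap F[X] (RatFunc F) a =
      algebraMap F[X] (RatFunc F) g * e.repr v i := by
  obtain ⟨n, ⟨b⟩⟩ := exists_finite_basis L
  obtain ⟨g, hg, h⟩ := exists_common_denominator (A := F[X]) (b.extendOfIsLattice (RatFunc F)) e
  choose a ha using h
  refine ⟨g, hg, fun v hv i => ⟨∑ j, b.repr ⟨v, hv⟩ j * a j i, ?_⟩⟩
  conv_rhs => rw [← (b.extendOfIsLattice (RatFunc F)).sum_repr v]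
  simp only [map_sum, map_mul, ha, map_smul, Finsupp.coe_finsetSum, Finset.sum_apply,
    Finsupp.smul_apply, smul_eq_mul, Finset.mul_sum]
  refine Finset.sum_congr rfl fun j _ => ?_
  rw [extendOfIsLattice_repr b ⟨v, hv⟩]
  ring

theorem exists_smul_mem (L : Submodule F[X] W) [Submodule.IsLattice (RatFunc F) L]
    {κ : Type*} [Finite κ] (e : Module.Basis κ (RatFunc F) W) :
    ∃ g : F[X], g ≠ 0 ∧ ∀ i, g • e i ∈ L := by
  obtain ⟨n, ⟨b⟩⟩ := exists_finite_basis L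
  obtain ⟨g, hg, h⟩ := exists_common_denominator (A := F[X]) e (b.extendOfIsLattice (RatFunc F))
  refine ⟨g, hg, fun i => ?_⟩
  rw [← (b.extendOfIsLattice (RatFunc F)).sum_repr (e i), Finset.smul_sum]
  refine Submodule.sum_mem _ fun j _ => ?_
  obtain ⟨a, ha⟩ := h i j
  rw [← IsScalarTower.algebraMap_smul (RatFunc F) g, smul_smul, ← ha,
    IsScalarTower.algebraMap_smul, Module.Basis.extendOfIsLattice_apply]
  exact L.smul_mem _ (b j).2

variable [NeZero (2 : F)] {Q : QuadraticForm (RatFunc F) W}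

/-- In the basis of `IsDefinite.exists_basis` the coordinates have degree at most `N`, and on `L`
they have a common denominator `g`. Only finitely many polynomials over `F` have degree at most `deg
g + N`. -/
theorem IsDefinite.finite_latticeBall [Finite F] (hQ : IsDefinite Q) (L : Submodule F[X] W)
    [Submodule.IsLattice (RatFunc F) L] (N : ℕ) : Finite (hQ.latticeBall L N) := by
  have := module_finite_of_isLattice L
  obtain ⟨e, he, hle⟩ := hQ.exists_basis
  obtain ⟨g, hg, h⟩ := exists_denominator_repr L e
  choose a ha using fun v : hQ.latticeBall L N => h v v.2.1
  have hdeg : ∀ v i, (a v i).natDegree ≤ g.natDegree + N := fun v i => by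
    rw [← inftyVal_algebraMap_le_iff, ha, map_mul, inftyVal_algebraMap hg, Nat.cast_add, exp_add]
    exact mul_le_mul' le_rfl (le_exp_of_sq_mul_le (he i).2 ((hle v i).trans v.2.2))
  have := finite_natDegree_le F (g.natDegree + N)
  refine Finite.of_injective (fun v i => (⟨a v i, hdeg v i⟩ :
    {f : F[X] // f.natDegree ≤ g.natDegree + N})) fun v w hvw => Subtype.ext ?_
  refine e.repr.injective (Finsupp.ext fun i => ?_)
  have h1 : a v i = a w i := congrArg Subtype.val (congrFun hvw i)
  have hg' : algebraMap F[X] (RatFunc F) g ≠ 0 := by simpa using hg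
  exact mul_left_cancel₀ hg' (by rw [← ha, ← ha, h1])

theorem IsDefinite.finite_fiber [Finite F] (hQ : IsDefinite Q) (L : Submodule F[X] W)
    [Submodule.IsLattice (RatFunc F) L] (a : RatFunc F) : {v : W | v ∈ L ∧ Q v = a}.Finite := by
  obtain ⟨N, hN⟩ := exists_le_exp_two_mul (inftyVal F a)
  have := hQ.finite_latticeBall L N
  refine (Set.toFinite (hQ.latticeBall L N : Set W)).subset fun v hv => ?_
  exact ⟨hv.1, (congrArg (inftyVal F) hv.2).trans_le hN⟩

variable {W' : Type*} [AddCommGroup W'] [Module (RatFunc F) W'] [Module F[X] W']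
  [Submodule.IsLattice (RatFunc F) L] [IsScalarTower F[X] (RatFunc F) W']
  {Q' : QuadraticForm (RatFunc F) W'} {L' : Submodule F[X] W'} [Submodule.IsLattice (RatFunc F) L']

theorem Isospectral.exists_equiv [Finite F] (hQ : IsDefinite Q) (hQ' : IsDefinite Q')
    (h : Isospectral L Q L' Q') : ∃ e : L ≃ L', ∀ v : L, Q' (e v) = Q v := by
  have hfib : ∀ a, Nonempty ({v : L // Q v = a} ≃ {v : L' // Q' v = a}) := fun a => by
    have := (hQ.finite_fiber L a).to_subtype
    have := (hQ'.finite_fiber L' a).to_subtype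
    -- Fibres are finite, so equal representation numbers in `ℕ∞` are equal natural numbers.
    have h1 : Nat.card {v : W | v ∈ L ∧ Q v = a} = Nat.card {v : W' | v ∈ L' ∧ Q' v = a} := by
      rw [Nat.card_coe_set_eq, Nat.card_coe_set_eq, Set.ncard, Set.ncard]
      exact congrArg ENat.toNat (h a)
    exact ⟨(Equiv.subtypeSubtypeEquivSubtypeInter (· ∈ L) (fun v => Q v = a)).trans
      ((Finite.card_eq.1 h1).some.trans
        (Equiv.subtypeSubtypeEquivSubtypeInter (· ∈ L') (fun v => Q' v = a)).symm)⟩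
  let f := fun a => (hfib a).some
  refine ⟨(Equiv.sigmaFiberEquiv fun v : L => Q v).symm.trans ((Equiv.sigmaCongrRight f).trans
    (Equiv.sigmaFiberEquiv fun v : L' => Q' v)), fun v => ?_⟩
  exact (f (Q v) ⟨v, rfl⟩).2

theorem Isospectral.exists_equiv_latticeBall [Finite F] (hQ : IsDefinite Q) (hQ' : IsDefinite Q')
    (h : Isospectral L Q L' Q') (N : ℕ) :
    ∃ e : hQ.latticeBall L N ≃ hQ'.latticeBall L' N, ∀ v, Q' (e v) = Q v := by
  obtain ⟨e, he⟩ := h.exists_equiv hQ hQ'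
  have he' : ∀ v, Q (e.symm v) = Q' v := fun v => by rw [← he, e.apply_symm_apply]
  refine ⟨⟨fun v => ⟨e ⟨v, v.2.1⟩, (e _).2, ?_⟩, fun v => ⟨e.symm ⟨v, v.2.1⟩, (e.symm _).2, ?_⟩,
    fun v => Subtype.ext (by simp), fun v => Subtype.ext (by simp)⟩, fun v => he _⟩
  · exact IsDefinite.mem_ball.2 ((congrArg (inftyVal F) (he _)).trans_le v.2.2)
  · exact IsDefinite.mem_ball.2 ((congrArg (inftyVal F) (he' _)).trans_le v.2.2)

end Lattice

/-! ### Valuation rings and sampling at the finite primes. -/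

section Integers

variable {E : Type*} [Field E] [Valued E ℤᵐ⁰] {O : Type*} [CommRing O] [Algebra O E]

theorem isUnit_two_of_integers (hO : (Valued.v : Valuation E ℤᵐ⁰).Integers O)
    (h2 : Valued.v (2 : E) = 1) : IsUnit (2 : O) :=
  hO.isUnit_of_one (by rw [map_ofNat]; exact isUnit_iff_ne_zero.2 fun h => by simp [h] at h2)
    (by rw [map_ofNat, h2])

theorem isSquare_one_add_of_integers [IsLocalRing O] [CompleteSpace E]
    (hO : (Valued.v : Valuation E ℤᵐ⁰).Integers O) (h2 : Valued.v (2 : E) = 1) :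
    ∀ m ∈ IsLocalRing.maximalIdeal O, IsSquare (1 + m) := by
  intro m hm
  have hlt : Valued.v (algebraMap O E m) < 1 := by
    refine lt_of_le_of_ne (hO.map_le_one m) fun h => (IsLocalRing.mem_maximalIdeal _).1 hm ?_
    exact hO.isUnit_of_one (isUnit_iff_ne_zero.2 fun h0 => by simp [h0] at h) h
  obtain ⟨s, hs⟩ := exists_one_add_eq_mul_self h2 hlt
  have hs1 : Valued.v s ≤ 1 := by
    by_contra! hs1
    have h1 : Valued.v (s * s) ≤ 1 := by
      rw [← hs, ← map_one (algebraMap O E), ← map_add]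
      exact hO.map_le_one _
    rw [map_mul] at h1
    exact absurd h1 (not_le.2 (one_lt_mul'' hs1 hs1))
  obtain ⟨t, rfl⟩ := hO.exists_of_le_one hs1
  exact ⟨t, hO.hom_inj (by rw [map_add, map_one, hs, map_mul])⟩

theorem mem_of_integers_of_valuation_le (hO : (Valued.v : Valuation E ℤᵐ⁰).Integers O) {I : Ideal O}
    {a x : O} (ha : a ∈ I) (h : Valued.v (algebraMap O E x) ≤ Valued.v (algebraMap O E a)) :
    x ∈ I := by
  obtain ⟨y, rfl⟩ := hO.dvd_of_le h
  exact I.mul_mem_right _ ha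

end Integers

/-- An ideal with representatives of bounded degree has finite index. -/
theorem finite_quotient_of_natDegree_le {F O : Type*} [Field F] [Finite F] [CommRing O]
    {I : Ideal O} (φ : F[X] → O) (n : ℕ)
    (h : ∀ x, ∃ f : F[X], f.natDegree ≤ n ∧ φ f - x ∈ I) : Finite (O ⧸ I) := by
  have := finite_natDegree_le F n
  refine Finite.of_surjective
    (fun f : {f : F[X] // f.natDegree ≤ n} => Ideal.Quotient.mk I (φ f)) fun x => ?_
  obtain ⟨x, rfl⟩ := Ideal.Quotient.mk_surjective x
  obtain ⟨f, hf, hfx⟩ := h x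
  exact ⟨⟨f, hf⟩, Ideal.Quotient.eq.2 hfx⟩

section FinitePlace

variable {F : Type*} [Field F] (p : HeightOneSpectrum F[X])

local notation "Eₚ" => p.adicCompletion (RatFunc F)
local notation "Oₚ" => p.adicCompletionIntegers (RatFunc F)

theorem valued_algebraMap_adicCompletion (x : RatFunc F) :
    Valued.v (algebraMap (RatFunc F) Eₚ x) = p.valuation (RatFunc F) x :=
  HeightOneSpectrum.valuedAdicCompletion_eq_valuation' p x

theorem algebraMap_adicCompletionIntegers (f : F[X]) :
    algebraMap Oₚ Eₚ (algebraMap F[X] Oₚ f) =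
      algebraMap (RatFunc F) Eₚ (algebraMap F[X] (RatFunc F) f) := rfl

theorem valued_two_adicCompletion [NeZero (2 : F)] : Valued.v (2 : Eₚ) = 1 := by
  rw [← map_ofNat (algebraMap (RatFunc F) Eₚ) 2, valued_algebraMap_adicCompletion,
    ← map_ofNat (algebraMap F[X] (RatFunc F)) 2,
    HeightOneSpectrum.valuation_eq_one_iff_notMem]
  intro h
  have hu : IsUnit (2 : F[X]) := by
    rw [← map_ofNat Polynomial.C 2]
    exact Polynomial.isUnit_C.2 (NeZero.ne (2 : F)).isUnit
  exact p.isPrime.ne_top (Ideal.eq_top_of_isUnit_mem _ h hu)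

/-- Density of `F(t)` gives an approximation `y`; being `p`-integral, `y` is in turn approximated by
a polynomial. -/
theorem exists_algebraMap_sub_mem {I : Ideal Oₚ} (hI : I ≠ ⊥) (x : Oₚ) :
    ∃ f : F[X], algebraMap F[X] Oₚ f - x ∈ I := by
  have hO := HeightOneSpectrum.adicCompletionIntegers.integers (K := RatFunc F) p
  obtain ⟨a, ha, ha0⟩ := Submodule.exists_mem_ne_zero_of_ne_bot hI
  have ha0' : algebraMap Oₚ Eₚ a ≠ 0 := by simpa using ha0
  have hva : Valued.v (algebraMap Oₚ Eₚ a) ≠ 0 := by rwa [Valuation.ne_zero_iff]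
  obtain ⟨y, hy⟩ := exists_sub_valuation_le_of_denseRange
    (HeightOneSpectrum.denseRange_algebraMap (RatFunc F) p) (algebraMap Oₚ Eₚ x) ha0'
  have hy1 : p.valuation (RatFunc F) y ≤ 1 := by
    rw [← valued_algebraMap_adicCompletion, ← sub_add_cancel (algebraMap _ Eₚ y)]
    exact (Valuation.map_add _ _ _).trans (max_le (hy.trans (hO.map_le_one a)) (hO.map_le_one x))
  obtain ⟨f, hf⟩ := HeightOneSpectrum.exists_valuation_sub_lt_of_integer p hy1 (Units.mk0 _ hva)
  refine ⟨f, mem_of_integers_of_valuation_le hO ha ?_⟩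
  rw [map_sub, algebraMap_adicCompletionIntegers,
    ← sub_add_sub_cancel _ (algebraMap (RatFunc F) Eₚ y)]
  refine (Valuation.map_add _ _ _).trans (max_le ?_ hy)
  rw [← map_sub, valued_algebraMap_adicCompletion]
  exact hf.le

theorem exists_algebraMap_mem {I : Ideal Oₚ} (hI : I ≠ ⊥) :
    ∃ g : F[X], g ≠ 0 ∧ algebraMap F[X] Oₚ g ∈ I := by
  have hO := HeightOneSpectrum.adicCompletionIntegers.integers (K := RatFunc F) p
  obtain ⟨a, ha, ha0⟩ := Submodule.exists_mem_ne_zero_of_ne_bot hI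
  have hva : Valued.v (algebraMap Oₚ Eₚ a) ≠ 0 := by simpa [Valuation.ne_zero_iff] using ha0
  obtain ⟨π, hπ⟩ := p.valuation_exists_uniformizer' (RatFunc F)
  obtain ⟨n, hn⟩ := exists_pow_lt₀ (a := p.valuation (RatFunc F) (algebraMap F[X] (RatFunc F) π))
    (by rw [hπ, ← exp_zero, exp_lt_exp]; omega) (Units.mk0 _ hva)
  refine ⟨π ^ n, pow_ne_zero _ ?_, mem_of_integers_of_valuation_le hO ha ?_⟩
  · rintro rfl
    simp at hπ
    exact exp_ne_zero hπ.symm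
  · rw [algebraMap_adicCompletionIntegers, valued_algebraMap_adicCompletion, map_pow, map_pow]
    exact hn.le

theorem finite_quotient_adicCompletionIntegers [Finite F] {I : Ideal Oₚ} (hI : I ≠ ⊥) :
    Finite (Oₚ ⧸ I) := by
  obtain ⟨g, hg, hgI⟩ := exists_algebraMap_mem p hI
  refine finite_quotient_of_natDegree_le (algebraMap F[X] Oₚ) g.natDegree fun x => ?_
  obtain ⟨f, hf⟩ := exists_algebraMap_sub_mem p hI x
  -- Since `g` lies in `I`, Euclidean division by `g` bounds the degree of representatives.
  refine ⟨f % g, Polynomial.natDegree_le_natDegree (Polynomial.degree_mod_lt f hg).le, ?_⟩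
  have : algebraMap F[X] Oₚ (f % g) - x =
      (algebraMap F[X] Oₚ f - x) - algebraMap F[X] Oₚ g * algebraMap F[X] Oₚ (f / g) := by
    have h := congrArg (algebraMap F[X] Oₚ) (EuclideanDomain.mod_add_div f g)
    rw [map_add, map_mul] at h
    linear_combination h
  rw [this]
  exact I.sub_mem hf (I.mul_mem_right _ hgI)

variable [NeZero (2 : F)] {W : Type*} [AddCommGroup W] [Module (RatFunc F) W] [Module F[X] W]
  [IsScalarTower F[X] (RatFunc F) W] {Q : QuadraticForm (RatFunc F) W} {L : Submodule F[X] W}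
  [Submodule.IsLattice (RatFunc F) L]

/-- There are finitely many coordinate classes modulo `I`, each represented by a vector of `L`; a
large enough ball contains all the chosen representatives. -/
theorem exists_forall_isSampling_latticeBall [Finite F] (hQ : IsDefinite Q) {κ : Type*} [Fintype κ]
    (b : Module.Basis κ F[X] L) {I : Ideal Oₚ} (hI : I ≠ ⊥) :
    ∃ M, ∀ N, M ≤ N →
      IsSampling Eₚ (b.extendOfIsLattice (RatFunc F)) I (hQ.latticeBall L N) := by
  have := finite_quotient_adicCompletionIntegers p hI
  let := Fintype.ofFinite (κ → Oₚ ⧸ I)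
  choose f hf using fun x => exists_algebraMap_sub_mem p hI x
  let vec : (κ → Oₚ ⧸ I) → L := fun x => ∑ i, f (x i).out • b i
  choose N hN using fun x => exists_le_exp_two_mul (inftyVal F (Q (vec x)))
  refine ⟨Finset.univ.sup N, fun M hM => ⟨fun w hw => ?_, fun x => ?_⟩⟩
  · refine ⟨fun i => algebraMap F[X] Oₚ (b.repr ⟨w, hw.1⟩ i), fun i => ?_⟩
    rw [algebraMap_adicCompletionIntegers, ← extendOfIsLattice_repr]
  · let z : κ → Oₚ ⧸ I := fun i => Ideal.Quotient.mk I (x i)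
    have hz : ∀ i, (z i).out - x i ∈ I := fun i => Ideal.Quotient.eq.1 (Quotient.out_eq' _)
    refine ⟨vec z, hQ.latticeBall_mono ((Finset.le_sup (Finset.mem_univ z)).trans hM)
      ⟨(vec z).2, hN z⟩, fun i => algebraMap F[X] Oₚ (f (z i).out) - x i, fun i => ?_, fun i => ?_⟩
    · have := I.add_mem (hf (z i).out) (hz i)
      rwa [sub_add_sub_cancel] at this
    · rw [add_sub_cancel, algebraMap_adicCompletionIntegers, extendOfIsLattice_repr]
      congr 2
      simp only [vec]
      rw [b.repr_sum_self]

end FinitePlace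

/-! ### Sampling at infinity. -/

section InfinitePlace

variable (F : Type*) [Field F]

/-- The ring of integers of `K_∞`. -/
noncomputable abbrev OInfty : ValuationSubring (KInfty F) :=
  (Valued.v : Valuation (KInfty F) ℤᵐ⁰).valuationSubring

theorem integers_OInfty : (Valued.v : Valuation (KInfty F) ℤᵐ⁰).Integers (OInfty F) :=
  Valuation.valuationSubring.integers _

theorem valued_X_KInfty : Valued.v (algebraMap (RatFunc F) (KInfty F) (RatFunc.X ^ (-1 : ℤ))) =
    exp (-1) := by
  rw [valued_algebraMap_KInfty, inftyVal_X_zpow]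

instance : IsPrincipalIdealRing (OInfty F) := by
  rw [(integers_OInfty F).isPrincipalIdealRing_iff_not_denselyOrdered,
    WithZero.denselyOrdered_set_iff_subsingleton]
  simpa using (Valued.v : Valuation (KInfty F) ℤᵐ⁰).toMonoidWithZeroHom.range_nontrivial

instance : IsDiscreteValuationRing (OInfty F) where
  not_a_field' h := by
    have hO := integers_OInfty F
    obtain ⟨π, hπ⟩ := hO.exists_of_le_one (r := algebraMap (RatFunc F) (KInfty F)
      (RatFunc.X ^ (-1 : ℤ))) (by rw [valued_X_KInfty, ← exp_zero, exp_le_exp]; omega)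
    have hmem : π ∈ IsLocalRing.maximalIdeal (OInfty F) := by
      rw [IsLocalRing.mem_maximalIdeal]
      intro hu
      have := hO.one_of_isUnit hu
      rw [hπ, valued_X_KInfty, ← exp_zero] at this
      exact absurd (exp_injective this) (by omega)
    rw [h, Ideal.mem_bot] at hmem
    rw [hmem, map_zero, eq_comm, map_eq_zero] at hπ
    exact zpow_ne_zero _ RatFunc.X_ne_zero hπ

variable {F}

theorem exists_inftyVal_sub_le_one (r : RatFunc F) :
    ∃ d : F[X], inftyVal F (r - algebraMap F[X] (RatFunc F) d) ≤ 1 := by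
  have hd : r.denom ≠ 0 := r.denom_ne_zero
  have hd' : algebraMap F[X] (RatFunc F) r.denom ≠ 0 := by simpa using hd
  refine ⟨r.num / r.denom, ?_⟩
  have h := congrArg (algebraMap F[X] (RatFunc F)) (EuclideanDomain.mod_add_div r.num r.denom)
  rw [map_add, map_mul] at h
  have h1 : r - algebraMap F[X] (RatFunc F) (r.num / r.denom) =
      algebraMap F[X] (RatFunc F) (r.num % r.denom) / algebraMap F[X] (RatFunc F) r.denom := by
    rw [eq_div_iff hd', sub_mul]
    nth_rewrite 1 [← RatFunc.num_div_denom r]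
    rw [div_mul_cancel₀ _ hd', ← h]
    ring
  rw [h1, map_div₀, inftyVal_algebraMap hd, div_le_one₀ (by simp), inftyVal_algebraMap_le_iff]
  exact Polynomial.natDegree_le_natDegree (Polynomial.degree_mod_lt _ hd).le

/-- The multiples of `t^(-N) g` by polynomials approximate everything up to degree `deg g - N`,
which eventually is fine enough for `I`. The factor `g` serves to stay inside `L`. -/
theorem exists_forall_exists_algebraMap_eq {I : Ideal (OInfty F)} (hI : I ≠ ⊥) {g : F[X]}
    (hg : g ≠ 0) : ∃ M : ℕ, ∀ N : ℕ, M ≤ N → ∀ x : OInfty F, ∃ d : F[X], ∃ y ∈ I,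
      algebraMap (OInfty F) (KInfty F) (x + y) = algebraMap (RatFunc F) (KInfty F)
        (RatFunc.X ^ (-N : ℤ) * algebraMap F[X] (RatFunc F) (d * g)) := by
  have hO := integers_OInfty F
  obtain ⟨a, ha, ha0⟩ := Submodule.exists_mem_ne_zero_of_ne_bot hI
  have ha0' : algebraMap (OInfty F) (KInfty F) a ≠ 0 := by simpa using ha0
  have hva : Valued.v (algebraMap (OInfty F) (KInfty F) a) ≠ 0 := by rwa [Valuation.ne_zero_iff]
  refine ⟨(g.natDegree - log (Valued.v (algebraMap (OInfty F) (KInfty F) a))).toNat,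
    fun N hN x => ?_⟩
  obtain ⟨y, hy⟩ := exists_sub_valuation_le_of_denseRange denseRange_algebraMap_KInfty
    (algebraMap (OInfty F) (KInfty F) x) ha0'
  have hg' : algebraMap F[X] (RatFunc F) g ≠ 0 := by simpa using hg
  obtain ⟨d, hd⟩ := exists_inftyVal_sub_le_one
    (RatFunc.X ^ (N : ℤ) * y / algebraMap F[X] (RatFunc F) g)
  set u := RatFunc.X ^ (-N : ℤ) * algebraMap F[X] (RatFunc F) (d * g) with hu
  have hX : (RatFunc.X : RatFunc F) ^ (-N : ℤ) * RatFunc.X ^ (N : ℤ) = 1 := by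
    rw [← zpow_add₀ RatFunc.X_ne_zero, neg_add_cancel, zpow_zero]
  have h1 : y - u = (RatFunc.X ^ (N : ℤ) * y / algebraMap F[X] (RatFunc F) g -
      algebraMap F[X] (RatFunc F) d) * (algebraMap F[X] (RatFunc F) g * RatFunc.X ^ (-N : ℤ)) := by
    have h0 := div_mul_cancel₀ (RatFunc.X ^ (N : ℤ) * y) hg'
    rw [hu, map_mul]
    generalize (RatFunc.X : RatFunc F) ^ (-N : ℤ) = s at *
    generalize RatFunc.X ^ (N : ℤ) * y / algebraMap F[X] (RatFunc F) g = r at *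
    linear_combination (-y) * hX - s * h0
  have h2 : inftyVal F (y - u) ≤ Valued.v (algebraMap (OInfty F) (KInfty F) a) := by
    rw [h1, map_mul, map_mul, inftyVal_algebraMap hg, inftyVal_X_zpow, ← exp_add]
    refine (mul_le_mul' hd (le_refl _)).trans ?_
    rw [one_mul, ← exp_log hva, exp_le_exp]
    omega
  have h3 : Valued.v (algebraMap (RatFunc F) (KInfty F) u - algebraMap (OInfty F) (KInfty F) x) ≤
      Valued.v (algebraMap (OInfty F) (KInfty F) a) := by
    rw [← sub_add_sub_cancel _ (algebraMap (RatFunc F) (KInfty F) y)]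
    refine (Valuation.map_add _ _ _).trans (max_le ?_ hy)
    rwa [← map_sub, valued_algebraMap_KInfty, Valuation.map_sub_swap]
  obtain ⟨z, hz⟩ := hO.exists_of_le_one (h3.trans (hO.map_le_one a))
  refine ⟨d, z, mem_of_integers_of_valuation_le hO ha (by rwa [hz]), ?_⟩
  rw [map_add, hz, add_sub_cancel]

theorem finite_quotient_OInfty [Finite F] {I : Ideal (OInfty F)} (hI : I ≠ ⊥) :
    Finite (OInfty F ⧸ I) := by
  have hO := integers_OInfty F
  obtain ⟨N, hN⟩ := exists_forall_exists_algebraMap_eq hI (one_ne_zero (α := F[X]))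
  choose d y hy h using hN N le_rfl
  have hdeg : ∀ x, (d x).natDegree ≤ N := fun x => by
    have h1 := hO.map_le_one (x + y x)
    rw [h, valued_algebraMap_KInfty, mul_one, map_mul, inftyVal_X_zpow] at h1
    rw [← inftyVal_algebraMap_le_iff]
    have h2 := mul_le_mul' (le_refl (exp (N : ℤ))) h1
    rwa [← mul_assoc, ← exp_add, add_neg_cancel, exp_zero, one_mul, mul_one] at h2
  classical
  -- The default `0` covers polynomials `f` for which `t^(-N) f` is not integral; the chosen
  -- representatives `d x` avoid it.
  refine finite_quotient_of_natDegree_le (fun f : F[X] =>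
    if H : ∃ o, algebraMap (OInfty F) (KInfty F) o = algebraMap (RatFunc F) (KInfty F)
        (RatFunc.X ^ (-N : ℤ) * algebraMap F[X] (RatFunc F) f) then H.choose else 0) N
    fun x => ⟨d x, hdeg x, ?_⟩
  have h1 := h x
  rw [mul_one] at h1
  have H : ∃ o, algebraMap (OInfty F) (KInfty F) o = algebraMap (RatFunc F) (KInfty F)
      (RatFunc.X ^ (-N : ℤ) * algebraMap F[X] (RatFunc F) (d x)) := ⟨_, h1⟩
  simp only [dif_pos H]
  rw [hO.hom_inj (H.choose_spec.trans h1.symm), add_sub_cancel_left]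
  exact hy x

variable [NeZero (2 : F)] {W : Type*} [AddCommGroup W] [Module (RatFunc F) W] [Module F[X] W]
  [IsScalarTower F[X] (RatFunc F) W] {Q : QuadraticForm (RatFunc F) W} {L : Submodule F[X] W}
  [Submodule.IsLattice (RatFunc F) L]

/-- Scaling by `t^(-N)` turns the bound `N` on the degrees of coordinates into integrality.
Conversely `g • e i ∈ L`, so approximating each coordinate by `t^(-N) d g` uses only vectors of `L`.
-/
theorem exists_forall_isSampling_map_latticeBall (hQ : IsDefinite Q) {κ : Type*}
    [Fintype κ] {e : Module.Basis κ (RatFunc F) W}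
    (he : ∀ i, inftyVal F (Q (e i)) ≤ 1 ∧ exp (-1) ≤ inftyVal F (Q (e i)))
    (hle : ∀ w i, inftyVal F (e.repr w i) ^ 2 * inftyVal F (Q (e i)) ≤ inftyVal F (Q w))
    {I : Ideal (OInfty F)} (hI : I ≠ ⊥) :
    ∃ M, ∀ N, M ≤ N → IsSampling (KInfty F) e I ((hQ.latticeBall L N).map
      (DistribSMul.toAddMonoidHom W (RatFunc.X ^ (-N : ℤ) : RatFunc F))) := by
  have hO := integers_OInfty F
  obtain ⟨g, hg, hgL⟩ := exists_smul_mem L e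
  obtain ⟨M, hM⟩ := exists_forall_exists_algebraMap_eq hI hg
  refine ⟨M, fun N hN => ⟨?_, fun x => ?_⟩⟩
  · rintro _ ⟨v, hv, rfl⟩
    choose x hx using fun i => hO.exists_of_le_one (r := algebraMap (RatFunc F) (KInfty F)
      (e.repr ((RatFunc.X ^ (-N : ℤ) : RatFunc F) • v) i)) (by
        rw [valued_algebraMap_KInfty, map_smul, Finsupp.smul_apply, smul_eq_mul, map_mul,
          inftyVal_X_zpow]
        refine (mul_le_mul' le_rfl (le_exp_of_sq_mul_le (he i).2 ((hle v i).trans hv.2))).trans ?_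
        rw [← exp_add, neg_add_cancel, exp_zero])
    exact ⟨x, hx⟩
  · choose d y hy h using fun i => hM N hN (x i)
    let v : W := ∑ i, (algebraMap F[X] (RatFunc F) (d i * g)) • e i
    have hval : ∀ i, inftyVal F (algebraMap F[X] (RatFunc F) (d i * g)) ≤ exp (N : ℤ) := fun i => by
      have h1 := hO.map_le_one (x i + y i)
      rw [h, valued_algebraMap_KInfty, map_mul, inftyVal_X_zpow] at h1
      have h2 := mul_le_mul' (le_refl (exp (N : ℤ))) h1
      rwa [← mul_assoc, ← exp_add, add_neg_cancel, exp_zero, one_mul, mul_one] at h2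
    have hv : v ∈ hQ.latticeBall L N := by
      refine AddSubgroup.sum_mem _ fun i _ => ⟨?_, ?_⟩
      · rw [IsScalarTower.algebraMap_smul, mul_smul]
        exact L.smul_mem _ (hgL i)
      · refine IsDefinite.mem_ball.2 ?_
        rw [QuadraticMap.map_smul, smul_eq_mul, map_mul, map_mul, two_mul, exp_add]
        exact (mul_le_mul' (mul_le_mul' (hval i) (hval i)) (he i).1).trans_eq (mul_one _)
    refine ⟨_, ⟨v, hv, rfl⟩, y, hy, fun i => ?_⟩
    rw [h, DistribSMul.toAddMonoidHom_apply, map_smul, Finsupp.smul_apply, smul_eq_mul,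
      e.repr_sum_self]

end InfinitePlace

theorem two_mul_associated {R M : Type*} [CommRing R] [Invertible (2 : R)] [AddCommGroup M]
    [Module R M] (Q : QuadraticForm R M) (x y : M) :
    2 * QuadraticMap.associated (R := R) Q x y = QuadraticMap.polar Q x y := by
  rw [← QuadraticMap.polarBilin_apply_apply, ← QuadraticMap.two_nsmul_associated R Q]
  simp [two_mul, two_smul]

theorem exists_mul_associated_eq {F : Type*} [Field F] [NeZero (2 : F)] {W : Type*}
    [AddCommGroup W] [Module (RatFunc F) W] [Module F[X] W] {L : Submodule F[X] W}
    {κ : Type*} [Finite κ] (b : Module.Basis κ F[X] L)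
    (Q : QuadraticForm (RatFunc F) W) :
    ∃ c : F[X], c ≠ 0 ∧ ∀ i j, ∃ a : F[X], algebraMap F[X] (RatFunc F) a =
      algebraMap F[X] (RatFunc F) c *
        QuadraticMap.associated (R := RatFunc F) Q (b i : W) (b j : W) := by
  obtain ⟨c, hc⟩ := IsLocalization.exist_integer_multiples_of_finite (nonZeroDivisors F[X])
    (fun x : κ × κ => QuadraticMap.associated (R := RatFunc F) Q (b x.1 : W) (b x.2 : W))
  refine ⟨c, nonZeroDivisors.coe_ne_zero c, fun i j => ?_⟩
  obtain ⟨a, ha⟩ := hc (i, j)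
  exact ⟨a, ha.trans (Algebra.smul_def _ _)⟩

/-! ### Isometry at every place. -/

section Genus

variable {F : Type*} [Field F] {W : Type*} [AddCommGroup W] [Module (RatFunc F) W]
  {Q : QuadraticForm (RatFunc F) W}

theorem IsDefinite.exists_mul_associated_eq_OInfty [NeZero (2 : F)] (hQ : IsDefinite Q)
    {κ : Type*} {e : κ → W}
    (he : ∀ i, inftyVal F (Q (e i)) ≤ 1) (i j : κ) :
    ∃ o : OInfty F, algebraMap (OInfty F) (KInfty F) o = algebraMap (RatFunc F) (KInfty F)
      (1 * QuadraticMap.associated (R := RatFunc F) Q (e i) (e j)) := by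
  refine (integers_OInfty F).exists_of_le_one ?_
  have h1 := hQ.polar_le (he i) (he j)
  rw [← two_mul_associated, map_mul, inftyVal_two, one_mul] at h1
  rwa [one_mul, valued_algebraMap_KInfty]

theorem exists_equiv_map_smul {W' : Type*} [AddCommGroup W'] [Module (RatFunc F) W']
    {Q' : QuadraticForm (RatFunc F) W'} {S : AddSubgroup W} {S' : AddSubgroup W'} (e : S ≃ S')
    (he : ∀ w, Q' (e w) = Q w) {s : RatFunc F} (hs : s ≠ 0) :
    ∃ e₁ : S.map (DistribSMul.toAddMonoidHom W s) ≃ S'.map (DistribSMul.toAddMonoidHom W' s),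
      ∀ w, Q' (e₁ w) = Q w := by
  let f := S.equivMapOfInjective (DistribSMul.toAddMonoidHom W s) (smul_right_injective W hs)
  let f' := S'.equivMapOfInjective (DistribSMul.toAddMonoidHom W' s) (smul_right_injective W' hs)
  refine ⟨f.symm.toEquiv.trans (e.trans f'.toEquiv), fun w => ?_⟩
  obtain ⟨v, rfl⟩ := f.surjective w
  have h1 : ((f.symm.toEquiv.trans (e.trans f'.toEquiv)) (f v) : W') = s • (e v : W') := by
    change s • (e (f.symm (f v)) : W') = _
    rw [f.symm_apply_apply]
  have h2 : (f v : W) = s • (v : W) := rfl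
  rw [h1, h2, QuadraticMap.map_smul, QuadraticMap.map_smul, he]

variable [Module F[X] W] [IsScalarTower F[X] (RatFunc F) W] {L : Submodule F[X] W}
  [Submodule.IsLattice (RatFunc F) L]

theorem completionAt_eq_span (p : HeightOneSpectrum F[X]) {κ : Type*} [Fintype κ]
    (b : Module.Basis κ F[X] L) :
    completionAt p L = Submodule.span (p.adicCompletionIntegers (RatFunc F)) (Set.range
      ((b.extendOfIsLattice (RatFunc F)).baseChange (p.adicCompletion (RatFunc F)))) := by
  refine le_antisymm (Submodule.span_le.2 ?_) (Submodule.span_le.2 ?_)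
  · rintro _ ⟨v, hv, rfl⟩
    have h : (1 : p.adicCompletion (RatFunc F)) ⊗ₜ[RatFunc F] v =
        ∑ i, (algebraMap F[X] (p.adicCompletionIntegers (RatFunc F)) (b.repr ⟨v, hv⟩ i)) •
          (b.extendOfIsLattice (RatFunc F)).baseChange (p.adicCompletion (RatFunc F)) i := by
      conv_lhs => rw [← (b.extendOfIsLattice (RatFunc F)).sum_repr v, TensorProduct.tmul_sum]
      refine Finset.sum_congr rfl fun i _ => ?_
      rw [extendOfIsLattice_repr b ⟨v, hv⟩, Module.Basis.baseChange_apply,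
        ← IsScalarTower.algebraMap_smul (p.adicCompletion (RatFunc F))
          (algebraMap F[X] (p.adicCompletionIntegers (RatFunc F)) _),
        algebraMap_adicCompletionIntegers, TensorProduct.tmul_smul,
        algebraMap_smul (p.adicCompletion (RatFunc F))
          (algebraMap F[X] (RatFunc F) (b.repr ⟨v, hv⟩ i))]
    change (1 : p.adicCompletion (RatFunc F)) ⊗ₜ[RatFunc F] v ∈ Submodule.span _ _
    rw [h]
    exact Submodule.sum_mem _ fun i _ =>
      Submodule.smul_mem _ _ (Submodule.subset_span (Set.mem_range_self i))
  · rintro _ ⟨i, rfl⟩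
    refine Submodule.subset_span ⟨b i, (b i).2, ?_⟩
    rw [Module.Basis.baseChange_apply, Module.Basis.extendOfIsLattice_apply]

variable {W' : Type*} [AddCommGroup W'] [Module (RatFunc F) W'] [Module F[X] W']
  [IsScalarTower F[X] (RatFunc F) W'] {Q' : QuadraticForm (RatFunc F) W'}
  {L' : Submodule F[X] W'} [Submodule.IsLattice (RatFunc F) L'] [NeZero (2 : F)]
  [Finite F]

/-- Isospectral definite lattices have isometric coordinate forms at every finite prime. -/
theorem Isospectral.exists_localForms_equivalent (hQ : IsDefinite Q) (hQ' : IsDefinite Q')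
    (h : Isospectral L Q L' Q') (p : HeightOneSpectrum F[X]) {κ κ' : Type*} [Fintype κ] [Fintype κ']
    (b : Module.Basis κ F[X] L) (b' : Module.Basis κ' F[X] L') :
    ∃ (c : RatFunc F) (q : QuadraticForm (p.adicCompletionIntegers (RatFunc F))
        (κ → p.adicCompletionIntegers (RatFunc F)))
      (q' : QuadraticForm (p.adicCompletionIntegers (RatFunc F))
        (κ' → p.adicCompletionIntegers (RatFunc F))),
      c ≠ 0 ∧ IsLocalForm (E := p.adicCompletion (RatFunc F))
        (b.extendOfIsLattice (RatFunc F)) Q c q ∧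
      IsLocalForm (E := p.adicCompletion (RatFunc F))
        (b'.extendOfIsLattice (RatFunc F)) Q' c q' ∧ q.Equivalent q' := by
  have hO := HeightOneSpectrum.adicCompletionIntegers.integers (K := RatFunc F) p
  obtain ⟨c, hc, hcb⟩ := exists_mul_associated_eq b Q
  obtain ⟨c', hc', hcb'⟩ := exists_mul_associated_eq b' Q'
  -- Both forms are scaled by the same factor `c * c'`, so that their values remain comparable.
  obtain ⟨q, hq⟩ := exists_isLocalForm (E := p.adicCompletion (RatFunc F))
    (O := p.adicCompletionIntegers (RatFunc F)) (b.extendOfIsLattice (RatFunc F)) Q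
    (algebraMap F[X] (RatFunc F) (c * c')) fun i j => by
      obtain ⟨a, ha⟩ := hcb i j
      refine ⟨algebraMap F[X] _ (c' * a), ?_⟩
      rw [algebraMap_adicCompletionIntegers, Module.Basis.extendOfIsLattice_apply,
        Module.Basis.extendOfIsLattice_apply, map_mul _ c c', map_mul _ c' a, ha]
      congr 1
      ring
  obtain ⟨q', hq'⟩ := exists_isLocalForm (E := p.adicCompletion (RatFunc F))
    (O := p.adicCompletionIntegers (RatFunc F)) (b'.extendOfIsLattice (RatFunc F)) Q'
    (algebraMap F[X] (RatFunc F) (c * c')) fun i j => by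
      obtain ⟨a, ha⟩ := hcb' i j
      refine ⟨algebraMap F[X] _ (c * a), ?_⟩
      rw [algebraMap_adicCompletionIntegers, Module.Basis.extendOfIsLattice_apply,
        Module.Basis.extendOfIsLattice_apply, map_mul _ c c', map_mul _ c a, ha]
      congr 1
      ring
  have hcc : algebraMap F[X] (RatFunc F) (c * c') ≠ 0 := by simp [hc, hc']
  refine ⟨_, q, q', hcc, hq, hq', ?_⟩
  refine equivalent_of_isSampling (isUnit_two_of_integers hO (valued_two_adicCompletion p))
    (isSquare_one_add_of_integers hO (valued_two_adicCompletion p))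
    (fun I hI => finite_quotient_adicCompletionIntegers p hI) hQ.anisotropic hQ'.anisotropic
    hcc hq hq' fun I hI => ?_
  obtain ⟨M, hM⟩ := exists_forall_isSampling_latticeBall p hQ b hI
  obtain ⟨M', hM'⟩ := exists_forall_isSampling_latticeBall p hQ' b' hI
  obtain ⟨e, he⟩ := h.exists_equiv_latticeBall hQ hQ' (max M M')
  exact ⟨_, _, e, hQ.finite_latticeBall L _, he, hM _ (le_max_left _ _), hM' _ (le_max_right _ _)⟩

theorem Isospectral.isometricAt (hQ : IsDefinite Q) (hQ' : IsDefinite Q')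
    (h : Isospectral L Q L' Q') (p : HeightOneSpectrum F[X]) : IsometricAt p L Q L' Q' := by
  obtain ⟨n, ⟨b⟩⟩ := exists_finite_basis L
  obtain ⟨n', ⟨b'⟩⟩ := exists_finite_basis L'
  obtain ⟨c, q, q', hc, hq, hq', hqq⟩ := h.exists_localForms_equivalent hQ hQ' p b b'
  unfold IsometricAt
  rw [completionAt_eq_span p b, completionAt_eq_span p b']
  exact exists_isometryEquiv_of_basis _ _ (c := algebraMap (RatFunc F) _ c) (by simpa using hc)
    hq hq' hqq

theorem Isospectral.equivalent_atInfty (hQ : IsDefinite Q) (hQ' : IsDefinite Q')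
    (h : Isospectral L Q L' Q') : (atInfty Q).Equivalent (atInfty Q') := by
  have hO := integers_OInfty F
  have := module_finite_of_isLattice L
  have := module_finite_of_isLattice L'
  obtain ⟨e, he, hle⟩ := hQ.exists_basis
  obtain ⟨e', he', hle'⟩ := hQ'.exists_basis
  -- No scaling is needed here: the basis values have degree at most `0`, and Cauchy–Schwarz bounds
  -- the off-diagonal entries.
  obtain ⟨q, hq⟩ := exists_isLocalForm (E := KInfty F) (O := OInfty F) e Q 1
    (hQ.exists_mul_associated_eq_OInfty fun i => (he i).1)
  obtain ⟨q', hq'⟩ := exists_isLocalForm (E := KInfty F) (O := OInfty F) e' Q' 1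
    (hQ'.exists_mul_associated_eq_OInfty fun i => (he' i).1)
  have hqq : q.Equivalent q' := by
    refine equivalent_of_isSampling (isUnit_two_of_integers hO valued_two_KInfty)
      (isSquare_one_add_of_integers hO valued_two_KInfty)
      (fun I hI => finite_quotient_OInfty hI) hQ.anisotropic hQ'.anisotropic
      one_ne_zero hq hq' fun I hI => ?_
    obtain ⟨M, hM⟩ := exists_forall_isSampling_map_latticeBall (L := L) hQ he hle hI
    obtain ⟨M', hM'⟩ := exists_forall_isSampling_map_latticeBall (L := L') hQ' he' hle' hI
    obtain ⟨f, hf⟩ := h.exists_equiv_latticeBall hQ hQ' (max M M')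
    obtain ⟨f₁, hf₁⟩ := exists_equiv_map_smul f hf
      (zpow_ne_zero (-(max M M' : ℕ) : ℤ) RatFunc.X_ne_zero)
    have := hQ.finite_latticeBall L (max M M')
    exact ⟨_, _, f₁, .of_surjective _ (AddMonoidHom.addSubgroupMap_surjective _ _), hf₁,
      hM _ (le_max_left _ _), hM' _ (le_max_right _ _)⟩
  obtain ⟨E, -⟩ := exists_isometryEquiv_of_basis (O := OInfty F) (e.baseChange (KInfty F))
    (e'.baseChange (KInfty F)) (c := algebraMap (RatFunc F) _ 1) (by simp) hq hq' hqq
  exact ⟨E⟩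

end Genus

/-! ### Discriminants. -/

theorem IsLocalForm.algebraMap_discr' {K E O : Type*} [Field K] [Invertible (2 : K)] [Field E]
    [Algebra K E] [CommRing O] [Algebra O E] [Invertible (2 : O)] {W : Type*} [AddCommGroup W]
    [Module K W] {n : ℕ} {b : Module.Basis (Fin n) K W} {Q : QuadraticForm K W} {c : K}
    {q : QuadraticForm O (Fin n → O)} (hq : IsLocalForm (E := E) b Q c q) :
    algebraMap O E (QuadraticForm.discr' q) = algebraMap K E (c ^ n *
      (Matrix.of fun i j => QuadraticMap.polar Q (b i) (b j) / 2).det) := by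
  have h2 : (2 : E) ≠ 0 := by
    rw [← map_ofNat (algebraMap K E) 2]
    exact (map_ne_zero _).2 (Invertible.ne_zero 2)
  have hs : ∀ i j, algebraMap O E ((Pi.single i 1 : Fin n → O) j) =
      algebraMap K E (b.repr (b i) j) := fun i j => by
    rw [Module.Basis.repr_self, Finsupp.single_apply, Pi.single_apply]
    simp only [eq_comm (a := i)]
    split_ifs <;> simp
  have hM : (QuadraticForm.toMatrix' q).map (algebraMap O E) =
      (c • Matrix.of fun i j => QuadraticMap.polar Q (b i) (b j) / 2).map (algebraMap K E) := by
    ext i j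
    simp only [QuadraticForm.toMatrix', Matrix.map_apply, LinearMap.toMatrix₂'_apply,
      Matrix.smul_apply, Matrix.of_apply, smul_eq_mul]
    refine mul_left_cancel₀ h2 ?_
    have h3 : (2 : K) * (c * (QuadraticMap.polar Q (b i) (b j) / 2)) =
        c * Q (b i + b j) - c * Q (b i) - c * Q (b j) := by
      have := Invertible.ne_zero (2 : K)
      rw [QuadraticMap.polar]
      field_simp
    rw [← map_ofNat (algebraMap O E) 2, ← map_mul, two_mul_associated, map_ofNat,
      ← map_ofNat (algebraMap K E) 2, ← map_mul, h3, QuadraticMap.polar, map_sub, map_sub,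
      hq.algebraMap_eq (hs i), hq.algebraMap_eq (hs j), hq.algebraMap_eq (w := b i + b j),
      map_sub, map_sub]
    intro k
    rw [Pi.add_apply, map_add, hs, hs, map_add, Finsupp.add_apply, map_add]
  rw [QuadraticForm.discr', RingHom.map_det, RingHom.mapMatrix_apply, hM,
    ← RingHom.mapMatrix_apply, ← RingHom.map_det, Matrix.det_smul, Fintype.card_fin]

/-- An element of `F(t)` which is the square of a unit at every nonzero prime of `F[t]` is the square
of a unit of `F[t]`. -/
theorem exists_algebraMap_sq_eq {F : Type*} [Field F] (r : RatFunc F)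
    (h : ∀ p : HeightOneSpectrum F[X], ∃ u : (p.adicCompletionIntegers (RatFunc F))ˣ,
      algebraMap (RatFunc F) (p.adicCompletion (RatFunc F)) r =
        algebraMap (p.adicCompletionIntegers (RatFunc F)) (p.adicCompletion (RatFunc F)) u ^ 2) :
    ∃ w : F[X]ˣ, algebraMap F[X] (RatFunc F) w ^ 2 = r := by
  have hv : ∀ p : HeightOneSpectrum F[X], p.valuation (RatFunc F) r = 1 := fun p => by
    obtain ⟨u, hu⟩ := h p
    rw [← valued_algebraMap_adicCompletion, hu, map_pow,
      (HeightOneSpectrum.adicCompletionIntegers.integers (K := RatFunc F) p).one_of_isUnit u.isUnit,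
      one_pow]
  obtain ⟨f, rfl⟩ := HeightOneSpectrum.mem_integers_of_valuation_le_one _ r fun p => (hv p).le
  -- Both the element and its inverse are integral at all primes, so it is a unit of `F[t]`, hence a
  -- constant.
  obtain ⟨g, hg⟩ := HeightOneSpectrum.mem_integers_of_valuation_le_one (R := F[X]) _
    (algebraMap F[X] (RatFunc F) f)⁻¹ fun p => by rw [map_inv₀, hv p, inv_one]
  have hf0 : algebraMap F[X] (RatFunc F) f ≠ 0 := fun h0 => by
    have := hv (Polynomial.idealX F)
    simp [h0] at this
  have hfu : IsUnit f := by
    refine IsUnit.of_mul_eq_one g (IsFractionRing.injective F[X] (RatFunc F) ?_)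
    rw [map_mul, hg, mul_inv_cancel₀ hf0, map_one]
  obtain ⟨c, hc, rfl⟩ := Polynomial.isUnit_iff.1 hfu
  set p := Polynomial.idealX F
  have hO := HeightOneSpectrum.adicCompletionIntegers.integers (K := RatFunc F) p
  obtain ⟨u, hu⟩ := h p
  have hbot : Ideal.span {algebraMap F[X] (p.adicCompletionIntegers (RatFunc F)) Polynomial.X} ≠
      ⊥ := by
    rw [Ne, Ideal.span_singleton_eq_bot]
    intro h0
    have := congrArg (algebraMap _ (p.adicCompletion (RatFunc F))) h0
    rw [algebraMap_adicCompletionIntegers, map_zero, map_eq_zero] at this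
    exact RatFunc.X_ne_zero (by simpa using this)
  -- At the prime `(t)`, replacing the local root `u` by a polynomial `a` congruent to it gives `t ∣
  -- a² - c`; evaluation at `0` shows that `c = a(0)²` in `F`.
  obtain ⟨a, ha⟩ := exists_algebraMap_sub_mem p hbot (u : p.adicCompletionIntegers (RatFunc F))
  obtain ⟨d, hd⟩ := Ideal.mem_span_singleton.1 ha
  have hX : p.valuation (RatFunc F) (algebraMap F[X] (RatFunc F) Polynomial.X) < 1 := by
    rw [HeightOneSpectrum.valuation_lt_one_iff_mem]
    exact Ideal.mem_span_singleton_self _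
  have hlt : p.valuation (RatFunc F)
      (algebraMap F[X] (RatFunc F) (a ^ 2 - Polynomial.C c)) < 1 := by
    rw [← valued_algebraMap_adicCompletion, map_sub, map_sub, hu,
      ← algebraMap_adicCompletionIntegers, map_pow,
      ← map_pow _ (u : p.adicCompletionIntegers (RatFunc F)), ← map_sub, sq_sub_sq, hd,
      mul_left_comm, map_mul, map_mul, algebraMap_adicCompletionIntegers,
      valued_algebraMap_adicCompletion]
    exact mul_lt_one_of_lt_of_le hX (hO.map_le_one _)
  have hmem : Polynomial.X ∣ a ^ 2 - Polynomial.C c :=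
    Ideal.mem_span_singleton.1 ((p.valuation_lt_one_iff_mem (K := RatFunc F) _).1 hlt)
  rw [Polynomial.X_dvd_iff, Polynomial.coeff_sub, Polynomial.coeff_C_zero,
    Polynomial.coeff_zero_eq_eval_zero, Polynomial.eval_pow, sub_eq_zero] at hmem
  have ha0 : a.eval 0 ≠ 0 := fun h0 => hc.ne_zero (by rw [← hmem, h0, zero_pow two_ne_zero])
  refine ⟨Units.map Polynomial.C.toMonoidHom (Units.mk0 _ ha0), ?_⟩
  rw [← hmem, Polynomial.C_pow, map_pow]
  rfl

section Discriminant

variable {F : Type*} [Field F] [NeZero (2 : F)] [Finite F]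
  {W : Type*} [AddCommGroup W] [Module (RatFunc F) W] [Module F[X] W]
  [IsScalarTower F[X] (RatFunc F) W] {Q : QuadraticForm (RatFunc F) W} {L : Submodule F[X] W}
  [Submodule.IsLattice (RatFunc F) L]
  {W' : Type*} [AddCommGroup W'] [Module (RatFunc F) W'] [Module F[X] W']
  [IsScalarTower F[X] (RatFunc F) W'] {Q' : QuadraticForm (RatFunc F) W'}
  {L' : Submodule F[X] W'} [Submodule.IsLattice (RatFunc F) L']

theorem Isospectral.exists_unit_det_gram_eq (hQ : IsDefinite Q) (hQ' : IsDefinite Q')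
    (h : Isospectral L Q L' Q') (p : HeightOneSpectrum F[X]) {n n' : ℕ}
    (b : Module.Basis (Fin n) F[X] L) (b' : Module.Basis (Fin n') F[X] L') :
    ∃ u : (p.adicCompletionIntegers (RatFunc F))ˣ,
      algebraMap (RatFunc F) (p.adicCompletion (RatFunc F)) (gram Q b).det =
        algebraMap (p.adicCompletionIntegers (RatFunc F)) (p.adicCompletion (RatFunc F)) u ^ 2 *
          algebraMap (RatFunc F) (p.adicCompletion (RatFunc F)) (gram Q' b').det := by
  obtain ⟨c, q, q', hc, hq, hq', ⟨e⟩⟩ := h.exists_localForms_equivalent hQ hQ' p b b'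
  obtain rfl : n = n' := by
    simpa using e.toLinearEquiv.finrank_eq
  have hO := HeightOneSpectrum.adicCompletionIntegers.integers (K := RatFunc F) p
  let := (isUnit_two_of_integers hO (valued_two_adicCompletion p)).invertible
  have hqe : q = q'.comp e.toLinearEquiv.toLinearMap :=
    QuadraticMap.ext fun x => (e.map_app x).symm
  have hdet : IsUnit (LinearMap.toMatrix' e.toLinearEquiv.toLinearMap).det := by
    rw [LinearMap.det_toMatrix']
    exact e.toLinearEquiv.isUnit_det'
  have h1 := hq.algebraMap_discr'
  rw [hqe, QuadraticForm.discr'_comp, map_mul, hq'.algebraMap_discr'] at h1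
  simp only [Module.Basis.extendOfIsLattice_apply] at h1
  -- The unit is the determinant of the local isometry; the common factor `c ^ n` cancels because
  -- the ranks agree.
  refine ⟨hdet.unit, mul_left_cancel₀ (a := algebraMap (RatFunc F) (p.adicCompletion (RatFunc F))
    (c ^ n)) (by simp [hc]) ?_⟩
  rw [← map_mul]
  refine h1.symm.trans ?_
  rw [IsUnit.unit_spec, map_mul, map_mul]
  change _ * (_ * algebraMap _ _ (gram Q' b').det) = _
  ring

theorem Isospectral.exists_det_gram_eq (hQ : IsDefinite Q) (hQ' : IsDefinite Q')
    (h : Isospectral L Q L' Q') {n n' : ℕ}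
    (b : Module.Basis (Fin n) F[X] L) (b' : Module.Basis (Fin n') F[X] L') :
    ∃ w : F[X]ˣ, (gram Q b).det = algebraMap F[X] (RatFunc F) w ^ 2 * (gram Q' b').det := by
  have hu := fun p => h.exists_unit_det_gram_eq hQ hQ' p b b'
  by_cases h0 : (gram Q' b').det = 0
  · obtain ⟨u, hu⟩ := hu (Polynomial.idealX F)
    rw [h0, map_zero, mul_zero, map_eq_zero] at hu
    exact ⟨1, by rw [hu, h0, mul_zero]⟩
  · obtain ⟨w, hw⟩ := exists_algebraMap_sq_eq ((gram Q b).det / (gram Q' b').det) fun p => by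
      obtain ⟨u, hu⟩ := hu p
      exact ⟨u, by rw [map_div₀, hu, mul_div_cancel_right₀ _ ((map_ne_zero _).2 h0)]⟩
    exact ⟨w, by rw [hw, div_mul_cancel₀ _ h0]⟩

/-- Isospectrality is symmetric, so one inclusion gives equality. -/
theorem Isospectral.discriminant_subset (hQ : IsDefinite Q) (hQ' : IsDefinite Q')
    (h : Isospectral L Q L' Q') : discriminant L Q ⊆ discriminant L' Q' := by
  rintro _ ⟨n, b, u, rfl⟩
  obtain ⟨n', ⟨b'⟩⟩ := exists_finite_basis L'
  obtain ⟨w, hw⟩ := h.exists_det_gram_eq hQ hQ' b b'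
  refine ⟨n', b', u * w, ?_⟩
  rw [hw, Units.val_mul, map_mul]
  ring

end Discriminant

end FqtLattice

theorem mainTheorem6 {F : Type*} [Field F] [Finite F] [NeZero (2 : F)]
    {W : Type*} [AddCommGroup W] [Module (RatFunc F) W] [Module F[X] W]
    [IsScalarTower F[X] (RatFunc F) W]
    {W' : Type*} [AddCommGroup W'] [Module (RatFunc F) W'] [Module F[X] W']
    [IsScalarTower F[X] (RatFunc F) W']
    (L : Submodule F[X] W) [Submodule.IsLattice (RatFunc F) L]
    (L' : Submodule F[X] W') [Submodule.IsLattice (RatFunc F) L']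
    (Q : QuadraticForm (RatFunc F) W) (Q' : QuadraticForm (RatFunc F) W')
    (hQ : FqtLattice.IsDefinite Q) (hQ' : FqtLattice.IsDefinite Q')
    (hiso : FqtLattice.Isospectral L Q L' Q') :
    FqtLattice.SameGenus L Q L' Q' ∧
      FqtLattice.discriminant L Q = FqtLattice.discriminant L' Q' := by
  have hiso' : FqtLattice.Isospectral L' Q' L Q := fun a => (hiso a).symm
  exact ⟨⟨fun p => hiso.isometricAt hQ hQ' p, hiso.equivalent_atInfty hQ hQ'⟩,
    (hiso.discriminant_subset hQ hQ').antisymm (hiso'.discriminant_subset hQ' hQ)⟩
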